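/- Let $(\varphi,\xi,\eta,g)$ be a paracontact metric structure on a smooth $3$-manifold $M$: $\varphi$ is a smooth $(1,1)$-tensor field, $\xi$ a smooth vector field, $\eta$ a smooth $1$-form and $g$ a smooth pseudo-Riemannian metric such that $$\varphi\xi=0,\quad \eta\circ\varphi=0,\quad \eta(\xi)=1,\quad \varphi^2=\mathrm{Id}-\eta\otimes\xi,$$ the $\pm1$-eigenbundles of $\varphi|_{\ker\eta}$ have equal rank, $g(\varphi X,\varphi Y)=-g(X,Y)+\eta(X)\eta(Y)$, and $g(X,\varphi Y)=d\eta(X,Y)$, where $d\eta(X,Y)=\tfrac12\bigl(X\eta(Y)-Y\eta(X)-\eta([X,Y])\bigr)$. Put $h=\tfrac12\mathcal L_\xi\varphi$. The structure is called paraSasakian on an open set if there $[\varphi,\varphi]-2\,d\eta\otimes\xi=0$, where $[\varphi,\varphi](X,Y)=\varphi^2[X,Y]+[\varphi X,\varphi Y]-\varphi[\varphi X,Y]-\varphi[X,\varphi Y]$ is the Nijenhuis torsion. By Darboux coordinates we mean a smooth chart $(x,y,z)$ of $M$ in which $\eta=\tfrac12(dz-y\,dx)$. Every point of $M$ lies in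 the domain of Darboux coordinates $(x,y,z)$, which can be chosen so that the image of the chart in $\mathbb R^3$ is convex. Moreover, in any Darboux coordinates $(x,y,z)$ the structure is given by $$\xi=2\partial_z,\qquad \eta=\tfrac12(dz-y\,dx),$$ $$g=\frac14\begin{pmatrix} a&b&-y\\ b&c&0\\ -y&0&1\end{pmatrix},\qquad \varphi=\begin{pmatrix}-b&-c&0\\ a-y^2&b&0\\ -by&-cy&0\end{pmatrix}$$ with respect to $\{\partial_x,\partial_y,\partial_z\}$ (the columns of the second matrix are the components of $\varphi\partial_x,\varphi\partial_y,\varphi\partial_z$), for some smooth functions $a,b,c$ of $(x,y,z)$ satisfying $ac-b^2-cy^2=-1$, and: (i) the structure is paraSasakian on the coordinate domain if and only if $a,b,c$ do not depend on $z$, that is, each of them is constant along every segment parallel to the $z$-axis contained in the image of the chart; (ii) at each point of the coordinate domain, $h^2=0$ if and only if $\operatorname{tr}h^2=0$, and $h^2=0$ if and only if $b_z^2-a_zc_z=0$. -/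

import Mathlib

open scoped Manifold ContDiff Bundle

noncomputable section

/-- An almost paracontact metric structure `(φ, ξ, η, g)` on a smooth manifold `M` modelled on `E`:
smooth tensor fields `φ` (type `(1,1)`), `ξ` (vector field), `η` (`1`-form) and a
pseudo-Riemannian metric `g` (smooth, symmetric, nondegenerate). -/
structure AlmostParacontactMetric (E : Type*) [NormedAddCommGroup E] [NormedSpace ℝ E]
    (M : Type*) [TopologicalSpace M] [ChartedSpace E M] [IsManifold 𝓘(ℝ, E) ∞ M] where
  φ : ∀ p : M, TangentSpace 𝓘(ℝ, E) p →L[ℝ] TangentSpace 𝓘(ℝ, E) p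
  ξ : ∀ p : M, TangentSpace 𝓘(ℝ, E) p
  η : ∀ p : M, TangentSpace 𝓘(ℝ, E) p →L[ℝ] ℝ
  g : ∀ p : M, TangentSpace 𝓘(ℝ, E) p →L[ℝ] TangentSpace 𝓘(ℝ, E) p →L[ℝ] ℝ
  smooth_φ : ContMDiff 𝓘(ℝ, E) (𝓘(ℝ, E).prod 𝓘(ℝ, E →L[ℝ] E)) ∞
    (fun p ↦ Bundle.TotalSpace.mk' (E →L[ℝ] E)
      (E := fun p : M ↦ TangentSpace 𝓘(ℝ, E) p →L[ℝ] TangentSpace 𝓘(ℝ, E) p) p (φ p))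
  smooth_ξ : ContMDiff 𝓘(ℝ, E) (𝓘(ℝ, E).prod 𝓘(ℝ, E)) ∞
    (fun p ↦ Bundle.TotalSpace.mk' E (E := fun p : M ↦ TangentSpace 𝓘(ℝ, E) p) p (ξ p))
  smooth_η : ContMDiff 𝓘(ℝ, E) (𝓘(ℝ, E).prod 𝓘(ℝ, E →L[ℝ] ℝ)) ∞
    (fun p ↦ Bundle.TotalSpace.mk' (E →L[ℝ] ℝ)
      (E := fun p : M ↦ TangentSpace 𝓘(ℝ, E) p →L[ℝ] ℝ) p (η p))
  smooth_g : ContMDiff 𝓘(ℝ, E) (𝓘(ℝ, E).prod 𝓘(ℝ, E →L[ℝ] E →L[ℝ] ℝ)) ∞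
    (fun p ↦ Bundle.TotalSpace.mk' (E →L[ℝ] E →L[ℝ] ℝ)
      (E := fun p : M ↦ TangentSpace 𝓘(ℝ, E) p →L[ℝ] TangentSpace 𝓘(ℝ, E) p →L[ℝ] ℝ) p (g p))
  φ_ξ : ∀ p, φ p (ξ p) = 0
  η_φ : ∀ p v, η p (φ p v) = 0
  η_ξ : ∀ p, η p (ξ p) = 1
  φ_φ : ∀ p v, φ p (φ p v) = v - η p v • ξ p
  /-- The two eigenbundles of `φ` restricted to `ker η`, for the eigenvalues `1` and `-1`,
  have equal rank. -/
  finrank_eigen : ∀ p,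
    Module.finrank ℝ ↥((η p).toLinearMap.ker ⊓ Module.End.eigenspace (φ p).toLinearMap 1) =
      Module.finrank ℝ ↥((η p).toLinearMap.ker ⊓ Module.End.eigenspace (φ p).toLinearMap (-1))
  g_symm : ∀ p v w, g p v w = g p w v
  g_nondegenerate : ∀ p v, (∀ w, g p v w = 0) → v = 0
  g_φ_φ : ∀ p v w, g p (φ p v) (φ p w) = -g p v w + η p v * η p w

namespace AlmostParacontactMetric

variable {E : Type*} [NormedAddCommGroup E] [NormedSpace ℝ E]
  {M : Type*} [TopologicalSpace M] [ChartedSpace E M] [IsManifold 𝓘(ℝ, E) ∞ M]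

/-- `dη(X, Y) = ½ (X (η Y) - Y (η X) - η [X, Y])`. -/
def dη (S : AlmostParacontactMetric E M) (X Y : ∀ p : M, TangentSpace 𝓘(ℝ, E) p) (p : M) : ℝ :=
  (1 / 2) * (mvfderiv 𝓘(ℝ, E) (fun q ↦ S.η q (Y q)) p (X p)
    - mvfderiv 𝓘(ℝ, E) (fun q ↦ S.η q (X q)) p (Y p)
    - S.η p (VectorField.mlieBracket 𝓘(ℝ, E) X Y p))

/-- The structure is paracontact metric: the fundamental `2`-form `Φ(X, Y) = g(X, φ Y)` is `dη`. -/
def IsParacontactMetric (S : AlmostParacontactMetric E M) : Prop :=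
  ∀ (p : M) (X Y : ∀ q : M, TangentSpace 𝓘(ℝ, E) q), MDiffAt (T% X) p → MDiffAt (T% Y) p →
    S.g p (X p) (S.φ p (Y p)) = S.dη X Y p

/-- The Nijenhuis torsion
`[φ, φ](X, Y) = φ² [X, Y] + [φ X, φ Y] - φ [φ X, Y] - φ [X, φ Y]`. -/
def nijenhuis (S : AlmostParacontactMetric E M) (X Y : ∀ p : M, TangentSpace 𝓘(ℝ, E) p) (p : M) :
    TangentSpace 𝓘(ℝ, E) p :=
  S.φ p (S.φ p (VectorField.mlieBracket 𝓘(ℝ, E) X Y p))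
    + VectorField.mlieBracket 𝓘(ℝ, E) (fun q ↦ S.φ q (X q)) (fun q ↦ S.φ q (Y q)) p
    - S.φ p (VectorField.mlieBracket 𝓘(ℝ, E) (fun q ↦ S.φ q (X q)) Y p)
    - S.φ p (VectorField.mlieBracket 𝓘(ℝ, E) X (fun q ↦ S.φ q (Y q)) p)

/-- The structure is normal on `U`: `[φ, φ] - 2 dη ⊗ ξ = 0` at every point of `U`. -/
def IsNormalOn (S : AlmostParacontactMetric E M) (U : Set M) : Prop :=
  ∀ p ∈ U, ∀ X Y : ∀ q : M, TangentSpace 𝓘(ℝ, E) q, MDiffAt (T% X) p → MDiffAt (T% Y) p →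
    S.nijenhuis X Y p - (2 * S.dη X Y p) • S.ξ p = 0

/-- The Lie derivative `(ℒ_ξ φ) X = [ξ, φ X] - φ [ξ, X]`. -/
def lieDerivφ (S : AlmostParacontactMetric E M) (X : ∀ p : M, TangentSpace 𝓘(ℝ, E) p) (p : M) :
    TangentSpace 𝓘(ℝ, E) p :=
  VectorField.mlieBracket 𝓘(ℝ, E) S.ξ (fun q ↦ S.φ q (X q)) p
    - S.φ p (VectorField.mlieBracket 𝓘(ℝ, E) S.ξ X p)

lemma mdiffAt_φ (S : AlmostParacontactMetric E M) {X : ∀ p : M, TangentSpace 𝓘(ℝ, E) p} {p : M}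
    (hX : MDiffAt (T% X) p) : MDiffAt (T% (fun q ↦ S.φ q (X q))) p :=
  MDifferentiableAt.clm_bundle_apply ((S.smooth_φ p).mdifferentiableAt (by simp)) hX

lemma tensorialAt_lieDerivφ [CompleteSpace E] (S : AlmostParacontactMetric E M) (p : M) :
    TensorialAt 𝓘(ℝ, E) E (S.lieDerivφ · p) p := by
  have : IsManifold 𝓘(ℝ, E) (minSmoothness ℝ 2) M :=
    IsManifold.of_le (n := ∞) (by
      simp only [minSmoothness_of_isRCLikeNormedField]
      exact ENat.LEInfty.out)
  constructor
  · intro f X hf hX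
    have h1 : (fun q ↦ S.φ q ((f • X) q)) = f • (fun q ↦ S.φ q (X q)) := by
      ext q; simp
    simp only [lieDerivφ]
    rw [h1, VectorField.mlieBracket_smul_right hf (S.mdiffAt_φ hX),
      VectorField.mlieBracket_smul_right hf hX]
    simp [smul_sub]
  · intro X Y hX hY
    have h1 : (fun q ↦ S.φ q ((X + Y) q)) = (fun q ↦ S.φ q (X q)) + (fun q ↦ S.φ q (Y q)) := by
      ext q; simp
    simp only [lieDerivφ]
    rw [h1, VectorField.mlieBracket_add_right (S.mdiffAt_φ hX) (S.mdiffAt_φ hY),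
      VectorField.mlieBracket_add_right hX hY]
    simp; abel

/-- The `(1,1)`-tensor `h = ½ ℒ_ξ φ`, as an endomorphism of each tangent space. -/
def h [CompleteSpace E] [FiniteDimensional ℝ E] (S : AlmostParacontactMetric E M) (p : M) :
    TangentSpace 𝓘(ℝ, E) p →L[ℝ] TangentSpace 𝓘(ℝ, E) p :=
  (1 / 2 : ℝ) • TensorialAt.mkHom (S.lieDerivφ · p) p (S.tensorialAt_lieDerivφ p)

lemma h_apply [CompleteSpace E] [FiniteDimensional ℝ E] (S : AlmostParacontactMetric E M) (p : M)
    {X : ∀ q : M, TangentSpace 𝓘(ℝ, E) q} (hX : MDiffAt (T% X) p) :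
    S.h p (X p) = (1 / 2 : ℝ) • S.lieDerivφ X p := by
  simp only [h, smul_apply]
  rw [TensorialAt.mkHom_apply (S.tensorialAt_lieDerivφ p) hX]

/-- The structure is paraSasakian on `U`: it is paracontact metric, and normal on `U`. -/
def IsParaSasakianOn (S : AlmostParacontactMetric E M) (U : Set M) : Prop :=
  S.IsParacontactMetric ∧ S.IsNormalOn U

end AlmostParacontactMetric

/-- The model space `ℝ³`; its points are the coordinate triples `(x, y, z)`. -/
abbrev E3 : Type := EuclideanSpace ℝ (Fin 3)

section Coordinates

variable {M : Type*} [TopologicalSpace M] [ChartedSpace E3 M]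

/-- The coordinate vector field `∂ᵢ` of a chart `e`: the pull-back under `e` of the `i`-th standard
basis field of `ℝ³`. -/
def coordField (e : OpenPartialHomeomorph M E3) (i : Fin 3) (p : M) : TangentSpace 𝓘(ℝ, E3) p :=
  VectorField.mpullback 𝓘(ℝ, E3) 𝓘(ℝ, E3) e (fun _ ↦ EuclideanSpace.single i (1 : ℝ)) p

/-- The differential of the `i`-th coordinate function of a chart `e`. -/
def coordDiff (e : OpenPartialHomeomorph M E3) (i : Fin 3) (p : M) :
    TangentSpace 𝓘(ℝ, E3) p →L[ℝ] ℝ :=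
  mvfderiv 𝓘(ℝ, E3) (fun q ↦ e q i) p

/-- `e = (x, y, z)` is a smooth chart of Darboux coordinates for the `1`-form `η`:
`η = ½ (dz - y dx)` on its domain. -/
def IsDarbouxChart (η : ∀ p : M, TangentSpace 𝓘(ℝ, E3) p →L[ℝ] ℝ)
    (e : OpenPartialHomeomorph M E3) : Prop :=
  e ∈ IsManifold.maximalAtlas 𝓘(ℝ, E3) ∞ M ∧
    ∀ p ∈ e.source, η p = (1 / 2 : ℝ) • (coordDiff e 2 p - e p 1 • coordDiff e 0 p)

end Coordinates

/-- The partial derivative `∂f/∂z`. -/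
def zDeriv (f : E3 → ℝ) (u : E3) : ℝ := fderiv ℝ f u (EuclideanSpace.single 2 1)

/-- `f` does not depend on `z` in `U`: it takes equal values at any two points of `U` that differ
only in `z` and are joined by a segment inside `U` (if `U` is convex, at any two points of `U` that
differ only in `z`). -/
def NotDependOnZ (f : E3 → ℝ) (U : Set E3) : Prop :=
  ∀ u ∈ U, ∀ v ∈ U, u 0 = v 0 → u 1 = v 1 → segment ℝ u v ⊆ U → f u = f v

/-- The matrix `(g(∂ᵢ, ∂ⱼ))`, where `a`, `b`, `c`, `y` are values at a point. -/
def metricMatrix (a b c y : ℝ) : Matrix (Fin 3) (Fin 3) ℝ :=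
  (1 / 4 : ℝ) • !![a, b, -y; b, c, 0; -y, 0, 1]

/-- The matrix of `φ`: its `j`-th column holds the components of `φ ∂ⱼ`. -/
def phiMatrix (a b c y : ℝ) : Matrix (Fin 3) (Fin 3) ℝ :=
  !![-b, -c, 0; a - y ^ 2, b, 0; -b * y, -c * y, 0]

end

/-! The identity g(X, φY) = dη(X, Y) makes η a contact form with Reeb field ξ: φξ = 0 gives dη(·, ξ)
= 0, and a vector Y of ker η with dη(·, Y) = 0 satisfies φY = 0 because g is nondegenerate, hence Y
= φ²Y = 0.

Darboux coordinates come from flows. At a point u₀ choose a field Y in ker η and a vector w with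
dη(Y, w) ≠ 0, start on the line u₀ + s w, follow Y for time t and then ξ for time z. In these
parameters η = dz + R ds with ∂R/∂t ≠ 0 at the origin, so (s, -2R, 2z) are Darboux coordinates
(`exists_contact_parametrization`, `exists_darboux_coordinates`). The flows must be smooth jointly
in time and initial point (`exists_smooth_flow`). This follows from the inverse function theorem in
the Banach space of curves on [0, 1], applied to the integral equation γ = x + τ ∫ f(γ).

In Darboux coordinates dη has constant coefficients, and the rest is algebra. The values g(∂ᵢ, φ∂ⱼ)
= dη(∂ᵢ, ∂ⱼ) and η ∘ φ = 0 give a linear system for the entries of φ, and φ² = Id - η ⊗ ξ forces its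
determinant (a - y²)c - b² to be -1 (`darboux_form`). Since ξ = 2∂_z, the components of h are the
z-derivatives of those of φ. The (x, y) block of h is traceless, so h² is governed by the scalar
b_z² - a_z c_z alone, which gives (ii).

For (i), the torsion paired with ∂_z is φ ∘ h, and φ is invertible on the x and y components, so
normality forces a_z = b_z = c_z = 0. Conversely, once the coefficients are free of z, the
components of [φ, φ] - 2 dη ⊗ ξ are combinations of the determinant relation and its x- and
y-derivatives. -/

open Topology Filter

/-! ### Calculus on spaces of continuous curves, and smooth local inverses. -/

section SmoothFlow

universe u

/-- A bilinear map applied pointwise to two continuous curves. -/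
noncomputable def ContinuousMap.bilinear (K : Type*) [TopologicalSpace K] [CompactSpace K]
    {G E F : Type*} [NormedAddCommGroup G] [NormedSpace ℝ G] [NormedAddCommGroup E]
    [NormedSpace ℝ E] [NormedAddCommGroup F] [NormedSpace ℝ F] (B : G →L[ℝ] E →L[ℝ] F) :
    C(K, G) →L[ℝ] C(K, E) →L[ℝ] C(K, F) :=
  LinearMap.mkContinuous₂
    (LinearMap.mk₂ ℝ (fun (φ : C(K, G)) (γ : C(K, E)) =>
        (⟨fun t => B (φ t) (γ t), by fun_prop⟩ : C(K, F)))
      (fun _ _ _ => by ext; simp) (fun _ _ _ => by ext; simp)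
      (fun _ _ _ => by ext; simp) (fun _ _ _ => by ext; simp)) ‖B‖
    (fun φ γ => by
      rw [ContinuousMap.norm_le _ (by positivity)]
      intro t
      refine (B.le_opNorm₂ (φ t) (γ t)).trans ?_
      gcongr
      · exact φ.norm_coe_le_norm t
      · exact γ.norm_coe_le_norm t)

/-- The mean value inequality is applied at each parameter t, on the segment from γ t to γ' t. The
bound on the variation of f' is uniform in t because postcomposition by f' is continuous for the sup
norm and the intermediate curves a • γ + b • γ' stay in a ball around γ. -/
lemma ContinuousMap.hasFDerivAt_comp_left {K : Type*} [TopologicalSpace K] [CompactSpace K]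
    {G E F : Type*} [NormedAddCommGroup G] [NormedSpace ℝ G] [NormedAddCommGroup E]
    [NormedSpace ℝ E] [NormedAddCommGroup F] [NormedSpace ℝ F] {f : E → F}
    (B : G →L[ℝ] E →L[ℝ] F) {f' : E → G}
    (hf : ∀ x, HasFDerivAt f (B (f' x)) x) (hc : Continuous f) (hc' : Continuous f')
    (γ : C(K, E)) :
    HasFDerivAt (fun γ : C(K, E) => (⟨f, hc⟩ : C(E, F)).comp γ)
      (ContinuousMap.bilinear K B ((⟨f', hc'⟩ : C(E, G)).comp γ)) γ := by
  rw [hasFDerivAt_iff_isLittleO, Asymptotics.isLittleO_iff]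
  intro ε hε
  have h1 := ((⟨f', hc'⟩ : C(E, G)).continuous_postcomp (X := K)).continuousAt (x := γ)
  obtain ⟨r, hr, h2⟩ := Metric.continuousAt_iff.1 h1 (ε / (‖B‖ + 1)) (by positivity)
  filter_upwards [Metric.ball_mem_nhds γ hr] with γ' hγ'
  rw [ContinuousMap.norm_le _ (by positivity)]
  intro t
  have h3 : ∀ y ∈ segment ℝ (γ t) (γ' t), ‖B (f' y) - B (f' (γ t))‖ ≤ ε := by
    rintro y ⟨a, b, ha, hb, hab, rfl⟩
    have h4 : a • γ + b • γ' ∈ Metric.ball γ r :=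
      (convex_ball γ r) (Metric.mem_ball_self hr) hγ' ha hb hab
    have h5 := h2 h4
    rw [dist_eq_norm] at h5
    have h6 : ‖f' (a • γ t + b • γ' t) - f' (γ t)‖ ≤ ε / (‖B‖ + 1) :=
      (ContinuousMap.norm_coe_le_norm ((⟨f', hc'⟩ : C(E, G)).comp (a • γ + b • γ') -
        (⟨f', hc'⟩ : C(E, G)).comp γ) t).trans h5.le
    rw [← map_sub]
    calc _ ≤ ‖B‖ * ‖f' (a • γ t + b • γ' t) - f' (γ t)‖ := B.le_opNorm _
      _ ≤ (‖B‖ + 1) * (ε / (‖B‖ + 1)) := by gcongr; linarith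
      _ = ε := by field_simp
  have h6 := (convex_segment (𝕜 := ℝ) (γ t) (γ' t)).norm_image_sub_le_of_norm_hasFDerivWithin_le'
    (f := f) (f' := fun y => B (f' y)) (φ := B (f' (γ t))) (C := ε)
    (fun x _ => (hf x).hasFDerivWithinAt) h3 (left_mem_segment ℝ _ _) (right_mem_segment ℝ _ _)
  calc _ = ‖f (γ' t) - f (γ t) - B (f' (γ t)) (γ' t - γ t)‖ := rfl
    _ ≤ ε * ‖γ' t - γ t‖ := h6
    _ ≤ ε * ‖γ' - γ‖ := by
      gcongr
      exact ContinuousMap.norm_coe_le_norm (γ' - γ) t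

/-- The derivative of postcomposition by f is postcomposition by f' followed by a continuous linear
map, so regularity climbs one order at a time. The target changes from F to E →L[ℝ] F in the
induction, hence the quantifier over F and the common universe. -/
lemma ContinuousMap.contDiff_nat_comp_left {K : Type*} [TopologicalSpace K] [CompactSpace K]
    {E : Type u} [NormedAddCommGroup E] [NormedSpace ℝ E] (n : ℕ) :
    ∀ {F : Type u} [NormedAddCommGroup F] [NormedSpace ℝ F] {f : E → F} (hc : Continuous f)
      (_ : ContDiff ℝ n f), ContDiff ℝ n (fun γ : C(K, E) => (⟨f, hc⟩ : C(E, F)).comp γ) := by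
  induction n with
  | zero =>
    intro F _ _ f hc hf
    exact contDiff_zero.2 (ContinuousMap.continuous_postcomp _)
  | succ n ih =>
    intro F _ _ f hc hf
    obtain ⟨f', hf', hd⟩ := contDiff_succ_iff_hasFDerivAt.1 hf
    refine contDiff_succ_iff_hasFDerivAt.2 ⟨_,
      (ContinuousMap.bilinear K (ContinuousLinearMap.id ℝ (E →L[ℝ] F))).contDiff.comp
        (ih hf'.continuous hf'),
      fun γ => ContinuousMap.hasFDerivAt_comp_left (ContinuousLinearMap.id ℝ (E →L[ℝ] F))
        hd hc hf'.continuous γ⟩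

/-- Composition on the left with a smooth map is smooth on spaces of continuous curves. -/
lemma ContinuousMap.contDiff_comp_left {K : Type*} [TopologicalSpace K] [CompactSpace K]
    {E F : Type u} [NormedAddCommGroup E] [NormedSpace ℝ E]
    [NormedAddCommGroup F] [NormedSpace ℝ F] {f : E → F} (hf : ContDiff ℝ ∞ f) :
    ContDiff ℝ ∞ (fun γ : C(K, E) => (⟨f, hf.continuous⟩ : C(E, F)).comp γ) :=
  contDiff_infty.2 fun n => ContinuousMap.contDiff_nat_comp_left n _ (contDiff_infty.1 hf n)

/-- The inverse function theorem, with a local inverse which is smooth on its whole domain. -/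
lemma exists_openPartialHomeomorph_of_isInvertible_fderiv
    {E F : Type*} [NormedAddCommGroup E] [NormedSpace ℝ E] [CompleteSpace E]
    [NormedAddCommGroup F] [NormedSpace ℝ F] [CompleteSpace F] {f : E → F} {x₀ : E}
    (hf : ∀ᶠ x in 𝓝 x₀, ContDiffAt ℝ ∞ f x) (h : (fderiv ℝ f x₀).IsInvertible) :
    ∃ e : OpenPartialHomeomorph E F, x₀ ∈ e.source ∧ (⇑e = f) ∧
      (∀ x ∈ e.source, ContDiffAt ℝ ∞ f x) ∧ ∀ y ∈ e.target, ContDiffAt ℝ ∞ e.symm y := by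
  obtain ⟨L, hL⟩ := h
  have hd : HasFDerivAt f (L : E →L[ℝ] F) x₀ := by
    rw [hL]; exact (hf.self_of_nhds.differentiableAt (by simp)).hasFDerivAt
  let e₀ := hf.self_of_nhds.toOpenPartialHomeomorph f hd (by simp)
  have he₀ : ⇑e₀ = f := rfl
  have hx₀ : x₀ ∈ e₀.source := hf.self_of_nhds.mem_toOpenPartialHomeomorph_source hd (by simp)
  -- Invertibility of the derivative is an open condition. Restricting to an open set where it holds
  -- makes the inverse smooth on its entire domain and not only at the image of x₀.
  have hinv : ∀ᶠ x in 𝓝 x₀, ∃ L : E ≃L[ℝ] F, (L : E →L[ℝ] F) = fderiv ℝ f x := by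
    have hc : ContinuousAt (fderiv ℝ f) x₀ :=
      (hf.self_of_nhds.fderiv_right (m := 0) (by simp)).continuousAt
    have := ContinuousLinearEquiv.nhds L
    rw [hL] at this
    exact hc.eventually this
  obtain ⟨s, hs, hso, hx₀s⟩ := eventually_nhds_iff.1 (hf.and hinv)
  refine ⟨e₀.restr s, ?_, he₀, ?_, ?_⟩
  · rw [e₀.restr_source' s hso]; exact ⟨hx₀, hx₀s⟩
  · intro x hx
    rw [e₀.restr_source' s hso] at hx
    exact (hs x hx.2).1
  · intro y hy
    have hy' := (e₀.restr s).map_target hy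
    rw [e₀.restr_source' s hso] at hy'
    obtain ⟨h1, L', hL'⟩ := hs _ hy'.2
    have h2 := h1.differentiableAt (by simp) |>.hasFDerivAt
    rw [← hL'] at h2
    exact e₀.contDiffAt_symm (f₀' := L') hy.1 h2 h1

/-- A smooth germ is the germ of a globally smooth map. -/
lemma exists_contDiff_eventuallyEq {E F : Type*} [NormedAddCommGroup E] [NormedSpace ℝ E]
    [FiniteDimensional ℝ E] [NormedAddCommGroup F] [NormedSpace ℝ F] {f : E → F} {x₀ : E}
    (hf : ∀ᶠ x in 𝓝 x₀, ContDiffAt ℝ ∞ f x) :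
    ∃ g : E → F, ContDiff ℝ ∞ g ∧ g =ᶠ[𝓝 x₀] f := by
  obtain ⟨r, hr, h⟩ := Metric.eventually_nhds_iff_ball.1 hf
  -- The support radius r / 2 is kept below r, so that χ • f is smooth also outside the ball where f
  -- is.
  let χ : ContDiffBump x₀ := ⟨r / 4, r / 2, by positivity, by linarith⟩
  refine ⟨fun x => χ x • f x, contDiff_iff_contDiffAt.2 fun x => ?_, ?_⟩
  · by_cases hx : x ∈ Metric.ball x₀ r
    · exact χ.contDiffAt.smul (h x hx)
    · have : x ∈ (tsupport χ)ᶜ := by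
        rw [χ.tsupport_eq]
        simp only [Set.mem_compl_iff, Metric.mem_closedBall, Metric.mem_ball, χ] at hx ⊢
        linarith
      refine contDiffAt_const (c := (0 : F)) |>.congr_of_eventuallyEq ?_
      filter_upwards [(isClosed_tsupport χ).isOpen_compl.mem_nhds this] with y hy
      rw [image_eq_zero_of_notMem_tsupport hy, zero_smul]
  · filter_upwards [χ.eventuallyEq_one] with x hx
    simp [hx]

/-! ### Smooth local flows from the integral equation on the unit interval. -/

open unitInterval

/-- The Volterra operator `γ ↦ ∫₀ᵗ γ` on continuous curves. -/
noncomputable def volterra (E : Type*) [NormedAddCommGroup E] [NormedSpace ℝ E] [CompleteSpace E] :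
    C(I, E) →L[ℝ] C(I, E) :=
  LinearMap.mkContinuous
    { toFun := fun γ => ⟨fun t => ∫ s in (0 : ℝ)..t, γ (Set.projIcc 0 1 zero_le_one s),
        (intervalIntegral.continuous_primitive (fun a b =>
          (Continuous.intervalIntegrable (by fun_prop) a b)) 0).comp continuous_subtype_val⟩
      map_add' := fun γ δ => by
        ext t
        exact intervalIntegral.integral_add (Continuous.intervalIntegrable (by fun_prop) _ _)
          (Continuous.intervalIntegrable (by fun_prop) _ _)
      map_smul' := fun c γ => by
        ext t
        exact intervalIntegral.integral_smul _ _ } 1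
    (fun γ => by
      rw [ContinuousMap.norm_le _ (by positivity)]
      intro t
      refine (intervalIntegral.norm_integral_le_of_norm_le_const
        (fun s _ => γ.norm_coe_le_norm _)).trans ?_
      rw [sub_zero, abs_of_nonneg t.2.1, one_mul]
      exact mul_le_of_le_one_right (norm_nonneg _) t.2.2)

lemma volterra_apply {E : Type*} [NormedAddCommGroup E] [NormedSpace ℝ E] [CompleteSpace E]
    (γ : C(I, E)) (t : I) :
    volterra E γ t = ∫ s in (0 : ℝ)..t, γ (Set.projIcc 0 1 zero_le_one s) := rfl

/-- Dilation of the parameter of a curve on the unit interval. -/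
lemma volterra_comp_mul {E : Type*} [NormedAddCommGroup E] [NormedSpace ℝ E] [CompleteSpace E]
    (γ : C(I, E)) (s : I) :
    (s : ℝ) • volterra E (γ.comp ⟨fun t => s * t, by fun_prop⟩) =
      (volterra E γ).comp ⟨fun t => s * t, by fun_prop⟩ := by
  ext t
  simp only [ContinuousMap.smul_apply, volterra_apply, ContinuousMap.comp_apply,
    ContinuousMap.coe_mk]
  have h : ∀ x ∈ Set.uIcc (0 : ℝ) t, γ (s * Set.projIcc 0 1 zero_le_one x) =
      γ (Set.projIcc 0 1 zero_le_one (s * x)) := by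
    intro x hx
    rw [Set.uIcc_of_le t.2.1] at hx
    have hx' : x ∈ Set.Icc (0 : ℝ) 1 := ⟨hx.1, hx.2.trans t.2.2⟩
    rw [Set.projIcc_of_mem _ hx',
      Set.projIcc_of_mem _ (unitInterval.mul_mem s.2 hx')]
    rfl
  rw [intervalIntegral.integral_congr h, intervalIntegral.smul_integral_comp_mul_left
    (fun x => γ (Set.projIcc 0 1 zero_le_one x))]
  simp

/-- Curves `γ` with `γ' = τ f(γ)`, `γ 0 = x` are the zeros in `γ` of the third component of this
map of `((τ, x), γ)`. -/
noncomputable def curveMap {E : Type*} [NormedAddCommGroup E] [NormedSpace ℝ E] [CompleteSpace E]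
    (f : C(E, E)) (q : (ℝ × E) × C(I, E)) : (ℝ × E) × C(I, E) :=
  (q.1, q.2 - (ContinuousLinearMap.const ℝ I q.1.2 + q.1.1 • volterra E (f.comp q.2)))


lemma curveMap_contDiff {E : Type*} [NormedAddCommGroup E] [NormedSpace ℝ E] [CompleteSpace E]
    {f : C(E, E)} (hf : ContDiff ℝ ∞ f) : ContDiff ℝ ∞ (curveMap f) := by
  have h := (ContinuousMap.contDiff_comp_left (K := I) hf).comp
    (contDiff_snd (E := ℝ × E) (F := C(I, E)))
  have h2 := (volterra E).contDiff.comp h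
  exact contDiff_fst.prodMk (contDiff_snd.sub
    (((ContinuousLinearMap.const ℝ I : E →L[ℝ] C(I, E)).contDiff.comp (contDiff_snd.comp contDiff_fst)).add
      ((contDiff_fst.comp contDiff_fst).smul h2)))

/-- At τ = 0 the term τ ∫ f(γ) does not vary with γ to first order. The differential is therefore
block unipotent, (q₁, q₂) ↦ (q₁, q₂ - B q₁), with inverse (q₁, q₂ + B q₁). -/
lemma isInvertible_fderiv_curveMap {E : Type*} [NormedAddCommGroup E] [NormedSpace ℝ E]
    [CompleteSpace E] {f : C(E, E)} (hf : ContDiff ℝ ∞ f) (x : E) (γ : C(I, E)) :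
    (fderiv ℝ (curveMap f) ((0, x), γ)).IsInvertible := by
  have h := (ContinuousMap.contDiff_comp_left (K := I) hf).comp
    (contDiff_snd (E := ℝ × E) (F := C(I, E)))
  have h2 := ((volterra E).contDiff.comp h).differentiable (by simp) ((0, x), γ) |>.hasFDerivAt
  let B : ℝ × E →L[ℝ] C(I, E) := (ContinuousLinearMap.const ℝ I).comp (.snd ℝ ℝ E) +
    (ContinuousLinearMap.fst ℝ ℝ E).smulRight (volterra E (f.comp γ))
  let fst' := ContinuousLinearMap.fst ℝ (ℝ × E) C(I, E)
  let snd' := ContinuousLinearMap.snd ℝ (ℝ × E) C(I, E)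
  have h3 : HasFDerivAt (curveMap f) (fst'.prod (snd' - B.comp fst')) ((0, x), γ) := by
    have h4 := fst'.hasFDerivAt (x := ((0, x), γ)) |>.prodMk <|
      (snd'.hasFDerivAt (x := ((0, x), γ))).sub <|
        (((ContinuousLinearMap.const ℝ I).comp ((ContinuousLinearMap.snd ℝ ℝ E).comp
          fst')).hasFDerivAt (x := ((0, x), γ))).add <|
        (((ContinuousLinearMap.fst ℝ ℝ E).comp fst').hasFDerivAt (x := ((0, x), γ))).smul h2
    refine h4.congr_fderiv ?_
    ext q <;> simp [B, fst', snd']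
    rfl
  rw [h3.fderiv]
  refine ContinuousLinearMap.IsInvertible.of_inverse (g := fst'.prod (snd' + B.comp fst')) ?_ ?_
  · ext q <;> simp [fst', snd']
  · ext q <;> simp [fst', snd']

/-- Smooth dependence on time and initial condition for autonomous differential equations. -/
lemma exists_smooth_flow_of_contDiff {E : Type*} [NormedAddCommGroup E] [NormedSpace ℝ E]
    [CompleteSpace E] {f : E → E} (hf : ContDiff ℝ ∞ f) (x₀ : E) :
    ∃ φ : ℝ × E → E, (∀ᶠ p in 𝓝 (0, x₀), ContDiffAt ℝ ∞ φ p) ∧ (∀ᶠ x in 𝓝 x₀, φ (0, x) = x) ∧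
      ∀ᶠ p in 𝓝 (0, x₀), HasDerivAt (fun s => φ (s, p.2)) (f (φ p)) p.1 := by
  let f' : C(E, E) := ⟨f, hf.continuous⟩
  let γ₀ : C(I, E) := ContinuousLinearMap.const ℝ I x₀
  obtain ⟨e, hs, he, -, hsymm⟩ := exists_openPartialHomeomorph_of_isInvertible_fderiv
    (f := curveMap f') (x₀ := ((0, x₀), γ₀))
    (.of_forall fun x => (curveMap_contDiff (f := f') hf).contDiffAt)
    (isInvertible_fderiv_curveMap (f := f') hf x₀ γ₀)
  have he₀ : e ((0, x₀), γ₀) = ((0, x₀), 0) := by rw [he]; simp [curveMap, γ₀]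
  have ht : ((0, x₀), 0) ∈ e.target := he₀ ▸ e.map_source hs
  -- The curve ψ (τ, x) is the trajectory from x up to time τ, rescaled to [0, 1]; the flow will be
  -- its value at 1.
  let ψ : ℝ × E → C(I, E) := fun p => (e.symm (p, 0)).2
  have hψ₀ : ψ (0, x₀) = γ₀ := by simp only [ψ]; rw [← he₀, e.left_inv hs]
  have hmem : ∀ᶠ p in 𝓝 ((0 : ℝ), x₀), (p, (0 : C(I, E))) ∈ e.target :=
    (Continuous.prodMk_left (0 : C(I, E))).continuousAt.eventually (e.open_target.mem_nhds ht)
  have hψ : ∀ p, (p, (0 : C(I, E))) ∈ e.target → ContDiffAt ℝ ∞ ψ p := fun p hp =>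
    contDiffAt_snd.comp p ((hsymm _ hp).comp p (contDiffAt_id.prodMk contDiffAt_const))
  have hψe : ∀ p, (p, (0 : C(I, E))) ∈ e.target → e.symm (p, 0) = (p, ψ p) ∧
      ψ p = ContinuousLinearMap.const ℝ I p.2 + p.1 • volterra E (f'.comp (ψ p)) := by
    intro p hp
    have h1 := e.right_inv hp
    rw [he, curveMap] at h1
    obtain ⟨h2, h3⟩ := Prod.mk.inj h1
    refine ⟨Prod.ext h2 rfl, ?_⟩
    rw [h2] at h3
    exact sub_eq_zero.1 h3
  obtain ⟨r, hr, hball⟩ := Metric.isOpen_iff.1 e.open_source _ hs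
  obtain ⟨ρ, hρ, hρball⟩ := Metric.eventually_nhds_iff_ball.1 (hmem.and
    (((hψ _ ht).continuousAt.eventually (Metric.ball_mem_nhds _ hr)).and
      (Metric.ball_mem_nhds ((0 : ℝ), x₀) hr)))
  rw [hψ₀] at hρball
  have hscale : ∀ τ x, (τ, x) ∈ Metric.ball ((0 : ℝ), x₀) ρ → ∀ s : I,
      ((s : ℝ) * τ, x) ∈ Metric.ball ((0 : ℝ), x₀) ρ := by
    intro τ x h s
    rw [← ball_prod_same] at h ⊢
    refine ⟨?_, h.2⟩
    have h1 := h.1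
    simp only [Metric.mem_ball, dist_zero_right, Real.norm_eq_abs, abs_mul] at h1 ⊢
    rw [abs_of_nonneg s.2.1]
    exact (mul_le_of_le_one_left (abs_nonneg _) s.2.2).trans_lt h1
  -- Uniqueness of solutions comes from injectivity of `e` on its source: the dilated curve solves
  -- the equation for time s * τ and remains in the ball of radius r around γ₀.
  have hrep : ∀ τ x, (τ, x) ∈ Metric.ball ((0 : ℝ), x₀) ρ → ∀ s : I,
      ψ (s * τ, x) = (ψ (τ, x)).comp ⟨fun t => s * t, by fun_prop⟩ := by
    intro τ x h s
    obtain ⟨h1, h2, h3⟩ := hρball _ h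
    obtain ⟨h1', -, h3'⟩ := hρball _ (hscale τ x h s)
    have h4 : (ψ (τ, x)).comp ⟨fun t => s * t, by fun_prop⟩ ∈ Metric.ball γ₀ r := by
      rw [ContinuousMap.dist_lt_iff hr] at h2
      rw [Metric.mem_ball, ContinuousMap.dist_lt_iff hr]
      exact fun t => h2 (s * t)
    have h5 : (((s : ℝ) * τ, x), (ψ (τ, x)).comp ⟨fun t => s * t, by fun_prop⟩) ∈ e.source := by
      apply hball
      rw [← ball_prod_same]
      exact ⟨h3', h4⟩
    have h6 := e.left_inv h5
    have h7 : e (((s : ℝ) * τ, x), (ψ (τ, x)).comp ⟨fun t => s * t, by fun_prop⟩) =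
        (((s : ℝ) * τ, x), 0) := by
      rw [he, curveMap]
      refine Prod.ext rfl (sub_eq_zero.2 ?_)
      have h8 := volterra_comp_mul (f'.comp (ψ (τ, x))) s
      have h9 := (hψe _ h1).2
      dsimp only at h9 ⊢
      rw [mul_comm, mul_smul, ← ContinuousMap.comp_assoc, h8]
      conv_lhs => rw [h9]
      ext t
      simp
    rw [h7] at h6
    exact congrArg Prod.snd h6
  -- By `hrep`, ψ (τ, x) s = ψ (s * τ, x) 1, so the integral equation along a single curve becomes
  -- an integral equation in the time τ, to which the fundamental theorem of calculus applies.
  have hint : ∀ τ x, (τ, x) ∈ Metric.ball ((0 : ℝ), x₀) ρ →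
      ψ (τ, x) 1 = x + ∫ u in (0 : ℝ)..τ, f (ψ (u, x) 1) := by
    intro τ x h
    have h1 := congrArg (fun γ : C(I, E) => γ 1) (hψe _ (hρball _ h).1).2
    simp only [ContinuousMap.add_apply, ContinuousMap.smul_apply, volterra_apply] at h1
    rw [h1]
    congr 1
    have h2 : ∀ s ∈ Set.uIcc (0 : ℝ) (1 : I), (f'.comp (ψ (τ, x))) (Set.projIcc 0 1 zero_le_one s) =
        f (ψ (s * τ, x) 1) := by
      intro s hs
      have hs' : s ∈ Set.Icc (0 : ℝ) 1 := by simpa [Set.uIcc_of_le] using hs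
      rw [hrep τ x h ⟨s, hs'⟩, Set.projIcc_of_mem _ hs']
      simp [f']
    rw [intervalIntegral.integral_congr h2,
      intervalIntegral.smul_integral_comp_mul_right (fun u => f (ψ (u, x) 1))]
    simp
  have hφ : ∀ p ∈ Metric.ball ((0 : ℝ), x₀) ρ, ContDiffAt ℝ ∞ (fun p => ψ p 1) p := fun p hp =>
    (ContinuousMap.evalCLM ℝ (1 : I) : C(I, E) →L[ℝ] E).contDiff.contDiffAt.comp p (hψ p (hρball p hp).1)
  refine ⟨fun p => ψ p 1, ?_, ?_, ?_⟩
  · filter_upwards [Metric.ball_mem_nhds _ hρ] with p hp using hφ p hp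
  · filter_upwards [Metric.ball_mem_nhds x₀ hρ] with x hx
    rw [hint 0 x (by rw [← ball_prod_same]; exact ⟨Metric.mem_ball_self hρ, hx⟩)]
    simp
  · filter_upwards [Metric.ball_mem_nhds _ hρ] with ⟨τ, x⟩ hp
    have hp' := hp
    rw [← ball_prod_same] at hp'
    have hcont : ContinuousOn (fun u => f (ψ (u, x) 1)) (Metric.ball 0 ρ) := by
      intro u hu
      have h1 : (u, x) ∈ Metric.ball ((0 : ℝ), x₀) ρ := by
        rw [← ball_prod_same]; exact ⟨hu, hp'.2⟩
      exact (hf.continuous.continuousAt.comp (ContinuousAt.comp (f := fun u => (u, x)) (x := u)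
        (hφ _ h1).continuousAt (by fun_prop))).continuousWithinAt
    have h2 : Set.uIcc 0 τ ⊆ Metric.ball (0 : ℝ) ρ :=
      (convex_ball (0 : ℝ) ρ).ordConnected.uIcc_subset (Metric.mem_ball_self hρ) hp'.1
    have h3 := intervalIntegral.integral_hasDerivAt_right (hcont.mono h2).intervalIntegrable
      (hcont.stronglyMeasurableAtFilter Metric.isOpen_ball τ hp'.1)
      (hcont.continuousAt (Metric.isOpen_ball.mem_nhds hp'.1))
    refine (h3.const_add x).congr_of_eventuallyEq ?_
    filter_upwards [Metric.isOpen_ball.mem_nhds hp'.1] with u hu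
    exact hint u x (by rw [← ball_prod_same]; exact ⟨hu, hp'.2⟩)

/-- A vector field which is smooth near a point has a smooth local flow there. -/
lemma exists_smooth_flow {E : Type*} [NormedAddCommGroup E] [NormedSpace ℝ E]
    [FiniteDimensional ℝ E] {f : E → E} {x₀ : E} (hf : ∀ᶠ x in 𝓝 x₀, ContDiffAt ℝ ∞ f x) :
    ∃ φ : ℝ × E → E, (∀ᶠ p in 𝓝 (0, x₀), ContDiffAt ℝ ∞ φ p) ∧ (∀ᶠ x in 𝓝 x₀, φ (0, x) = x) ∧
      ∀ᶠ p in 𝓝 (0, x₀), HasDerivAt (fun s => φ (s, p.2)) (f (φ p)) p.1 := by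
  have : CompleteSpace E := FiniteDimensional.complete ℝ E
  obtain ⟨g, hg, hgf⟩ := exists_contDiff_eventuallyEq hf
  obtain ⟨φ, h1, h2, h3⟩ := exists_smooth_flow_of_contDiff hg x₀
  refine ⟨φ, h1, h2, ?_⟩
  -- Near (0, x₀) the flow of the global extension g stays where g agrees with f.
  have h4 : Tendsto φ (𝓝 (0, x₀)) (𝓝 x₀) := by
    have := h1.self_of_nhds.continuousAt.tendsto
    rwa [h2.self_of_nhds] at this
  filter_upwards [h3, h4.eventually hgf] with p hp hp'
  rwa [← hp']

end SmoothFlow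

/-! ### Darboux' theorem for contact forms on ℝ³. -/

section DarbouxTheorem

/-- A function whose derivative vanishes along a segment takes equal values at its ends. -/
lemma eq_of_fderiv_segment_eq_zero {E : Type*} [NormedAddCommGroup E] [NormedSpace ℝ E]
    {f : E → ℝ} {u v : E} (hd : ∀ x ∈ segment ℝ u v, DifferentiableAt ℝ f x)
    (h : ∀ x ∈ segment ℝ u v, fderiv ℝ f x (v - u) = 0) : f u = f v := by
  obtain ⟨z, hz, h1⟩ := domain_mvt (f := f) (s := segment ℝ u v) (f' := fderiv ℝ f)
    (fun x hx => (hd x hx).hasFDerivAt.hasFDerivWithinAt) (convex_segment u v)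
    (left_mem_segment ℝ u v) (right_mem_segment ℝ u v)
  rw [h z hz] at h1
  linarith

lemma isInvertible_of_injective {E : Type*} [NormedAddCommGroup E] [NormedSpace ℝ E]
    [FiniteDimensional ℝ E] {L : E →L[ℝ] E} (h : ∀ v, L v = 0 → v = 0) : L.IsInvertible := by
  have h1 : Function.Injective L.toLinearMap := by
    rw [← LinearMap.ker_eq_bot, LinearMap.ker_eq_bot']; exact h
  exact ⟨(LinearEquiv.ofInjectiveEndo _ h1).toContinuousLinearEquiv, by ext; rfl⟩

section Pullback

variable {E E' : Type*} [NormedAddCommGroup E] [NormedSpace ℝ E]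
  [NormedAddCommGroup E'] [NormedSpace ℝ E']

lemma hasFDerivAt_pullback_apply {A : E → E →L[ℝ] ℝ} {F : E' → E} {p : E'}
    (hA : DifferentiableAt ℝ A (F p)) (hF : ContDiffAt ℝ 2 F p) (v w : E') :
    DifferentiableAt ℝ (fun q => A (F q) (fderiv ℝ F q v)) p ∧
    fderiv ℝ (fun q => A (F q) (fderiv ℝ F q v)) p w =
      fderiv ℝ A (F p) (fderiv ℝ F p w) (fderiv ℝ F p v) +
        A (F p) (fderiv ℝ (fderiv ℝ F) p w v) := by
  have h1 := (hA.hasFDerivAt.comp p (hF.differentiableAt (by simp)).hasFDerivAt)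
  have h2 := ((hF.fderiv_right (m := 1) (by norm_num)).differentiableAt (by simp)).hasFDerivAt
  have h3 := h1.clm_apply (h2.clm_apply (hasFDerivAt_const v p))
  refine ⟨h3.differentiableAt, ?_⟩
  erw [h3.fderiv]
  simp [add_comm]

/-- The exterior derivative commutes with pullback, for `1`-forms on normed spaces. -/
lemma fderiv_pullback_sub {A : E → E →L[ℝ] ℝ} {F : E' → E} {p : E'}
    (hA : DifferentiableAt ℝ A (F p)) (hF : ContDiffAt ℝ 2 F p) (v w : E') :
    fderiv ℝ (fun q => A (F q) (fderiv ℝ F q v)) p w -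
      fderiv ℝ (fun q => A (F q) (fderiv ℝ F q w)) p v =
    fderiv ℝ A (F p) (fderiv ℝ F p w) (fderiv ℝ F p v) -
      fderiv ℝ A (F p) (fderiv ℝ F p v) (fderiv ℝ F p w) := by
  rw [(hasFDerivAt_pullback_apply hA hF v w).2, (hasFDerivAt_pullback_apply hA hF w v).2]
  have := (hF.isSymmSndFDerivAt (by simp)).eq v w
  rw [this]
  ring

end Pullback

/-- Coordinate directions of the model space. -/
noncomputable abbrev E3.basisVec (i : Fin 3) : E3 := EuclideanSpace.single i 1

lemma E3.eq_sum (v : E3) :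
    v = v 0 • E3.basisVec 0 + v 1 • E3.basisVec 1 + v 2 • E3.basisVec 2 := by
  ext i; fin_cases i <;> simp

lemma E3.map_eq {F : Type*} [NormedAddCommGroup F] [NormedSpace ℝ F] (L : E3 →L[ℝ] F) (v : E3) :
    L v = v 0 • L (E3.basisVec 0) + v 1 • L (E3.basisVec 1) + v 2 • L (E3.basisVec 2) := by
  conv_lhs => rw [E3.eq_sum v]
  simp only [map_add, map_smul]

/-- A function on `ℝ³` with vanishing `z`-derivative which vanishes on `z = 0` is zero. -/
lemma eventually_eq_zero_of_fderiv_z {Q : E3 → ℝ}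
    (hd : ∀ᶠ p in 𝓝 (0 : E3), DifferentiableAt ℝ Q p ∧ fderiv ℝ Q p (E3.basisVec 2) = 0)
    (h0 : ∀ᶠ p in 𝓝 (0 : E3), p 2 = 0 → Q p = 0) : ∀ᶠ p in 𝓝 (0 : E3), Q p = 0 := by
  obtain ⟨r, hr, h⟩ := Metric.eventually_nhds_iff_ball.1 (hd.and h0)
  filter_upwards [Metric.ball_mem_nhds _ hr] with p hp
  -- Projecting to z = 0 does not increase the norm, so the vertical segment from q to p stays in
  -- the ball.
  let q : E3 := p - p 2 • E3.basisVec 2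
  have hq : q ∈ Metric.ball (0 : E3) r := by
    have h1 : ‖q‖ ≤ ‖p‖ := by
      rw [EuclideanSpace.norm_eq, EuclideanSpace.norm_eq]
      apply Real.sqrt_le_sqrt
      simp only [Fin.sum_univ_three, q]
      simp
      positivity
    rw [mem_ball_zero_iff] at hp ⊢
    exact h1.trans_lt hp
  have hseg := (convex_ball (0 : E3) r).segment_subset hq hp
  rw [← eq_of_fderiv_segment_eq_zero (f := Q) (u := q) (v := p) (fun x hx => (h x (hseg hx)).1.1)
    (fun x hx => by simp [q, (h x (hseg hx)).1.2])]
  exact (h q hq).2 (by simp [q])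

/-- In a neighbourhood of a point, a contact form on `ℝ³` with Reeb field `X` has a parametrization
`F` with `F^* A = dt + R du`. -/
lemma exists_contact_parametrization {A : E3 → E3 →L[ℝ] ℝ} {X : E3 → E3} {u₀ : E3}
    (hA : ∀ᶠ u in 𝓝 u₀, ContDiffAt ℝ ∞ A u) (hX : ∀ᶠ u in 𝓝 u₀, ContDiffAt ℝ ∞ X u)
    (hAX : ∀ᶠ u in 𝓝 u₀, A u (X u) = 1)
    (hdX : ∀ᶠ u in 𝓝 u₀, ∀ v, fderiv ℝ A u (X u) v = fderiv ℝ A u v (X u))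
    (hnd : ∀ Y, A u₀ Y = 0 → (∀ w, fderiv ℝ A u₀ Y w = fderiv ℝ A u₀ w Y) → Y = 0) :
    ∃ F : E3 → E3, F 0 = u₀ ∧ (∀ᶠ p in 𝓝 0, ContDiffAt ℝ ∞ F p) ∧ (fderiv ℝ F 0).IsInvertible ∧
      (∀ᶠ p in 𝓝 0, A (F p) (fderiv ℝ F p (E3.basisVec 2)) = 1) ∧
      (∀ᶠ p in 𝓝 0, A (F p) (fderiv ℝ F p (E3.basisVec 1)) = 0) ∧
      fderiv ℝ (fun p => A (F p) (fderiv ℝ F p (E3.basisVec 0))) 0 (E3.basisVec 1) ≠ 0 := by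
  -- If every vector were a multiple of X u₀, the space would have dimension at most 1. Subtracting
  -- the Reeb component of such a v gives the field Y in ker A, nonzero at u₀.
  obtain ⟨v, hv⟩ : ∃ v, v - A u₀ v • X u₀ ≠ 0 := by
    by_contra! h
    have := finrank_le_one (R := ℝ) (X u₀) fun w => ⟨A u₀ w, (sub_eq_zero.1 (h w)).symm⟩
    simp at this
  let Y : E3 → E3 := fun u => v - A u v • X u
  have hY : ∀ᶠ u in 𝓝 u₀, ContDiffAt ℝ ∞ Y u := by
    filter_upwards [hA, hX] with u h1 h2
    exact contDiffAt_const.sub ((h1.clm_apply contDiffAt_const).smul h2)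
  have hAY : ∀ᶠ u in 𝓝 u₀, A u (Y u) = 0 := by
    filter_upwards [hAX] with u h
    simp [Y, h]
  obtain ⟨w, hw⟩ : ∃ w, fderiv ℝ A u₀ (Y u₀) w ≠ fderiv ℝ A u₀ w (Y u₀) := by
    by_contra! h
    exact hv (hnd _ hAY.self_of_nhds h)
  obtain ⟨φ, hφ, hφ0, hφd⟩ := exists_smooth_flow hX
  obtain ⟨ψ, hψ, hψ0, hψd⟩ := exists_smooth_flow hY
  -- The coordinates p 0, p 1, p 2 are the position on the line u₀ + s w, the time along Y and the
  -- time along X.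
  let S : E3 → ℝ × E3 := fun p => (p 1, u₀ + p 0 • w)
  let T : E3 → ℝ × E3 := fun p => (p 2, ψ (S p))
  let F : E3 → E3 := fun p => φ (T p)
  have hS : ContDiff ℝ ∞ S := by fun_prop
  have hS0 : S 0 = (0, u₀) := by simp [S]
  have hSt : Tendsto S (𝓝 0) (𝓝 (0, u₀)) := hS0 ▸ hS.continuous.tendsto 0
  have hTc : ∀ᶠ p in 𝓝 0, ContDiffAt ℝ ∞ T p := by
    filter_upwards [hSt.eventually hψ] with p hp
    have h2 : ContDiffAt ℝ ∞ (fun p : E3 => p 2) p := by fun_prop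
    exact h2.prodMk (hp.comp p hS.contDiffAt)
  have hT0 : T 0 = (0, u₀) := by simp [T, hS0, hψ0.self_of_nhds]
  have hTt : Tendsto T (𝓝 0) (𝓝 (0, u₀)) := hT0 ▸ hTc.self_of_nhds.continuousAt.tendsto
  have hF : ∀ᶠ p in 𝓝 0, ContDiffAt ℝ ∞ F p := by
    filter_upwards [hTc, hTt.eventually hφ] with p h1 h2
    exact h2.comp p h1
  have hF0 : F 0 = u₀ := by simp [F, hT0, hφ0.self_of_nhds]
  have hFt : Tendsto F (𝓝 0) (𝓝 u₀) := by
    have := hF.self_of_nhds.continuousAt.tendsto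
    rwa [hF0] at this
  -- a derivative of `F` in the direction `eᵢ` is the derivative along the line
  have hline : ∀ p, ContDiffAt ℝ ∞ F p → ∀ i, HasDerivAt
      (fun s : ℝ => F (p + (s - p i) • E3.basisVec i)) (fderiv ℝ F p (E3.basisVec i)) (p i) := by
    intro p hp i
    have h1 : HasDerivAt (fun s : ℝ => p + (s - p i) • E3.basisVec i) (E3.basisVec i) (p i) := by
      simpa using (((hasDerivAt_id (p i)).sub_const (p i)).smul_const (E3.basisVec i)).const_add p
    have h2 : HasFDerivAt F (fderiv ℝ F p) (p + (p i - p i) • E3.basisVec i) := by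
      simpa using (hp.differentiableAt (by simp)).hasFDerivAt
    exact h2.comp_hasDerivAt (p i) h1
  have hF2 : ∀ᶠ p in 𝓝 0, fderiv ℝ F p (E3.basisVec 2) = X (F p) := by
    filter_upwards [hF, hTt.eventually hφd] with p h1 h2
    refine (hline p h1 2).unique ?_
    simpa [F, T, S] using h2
  have hF1 : ∀ᶠ p in 𝓝 0, p 2 = 0 → fderiv ℝ F p (E3.basisVec 1) = Y (F p) := by
    have h3 : Tendsto (fun p => ψ (S p)) (𝓝 0) (𝓝 u₀) := by
      have := (continuous_snd.tendsto (0, u₀)).comp hTt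
      exact this
    filter_upwards [hF, hSt.eventually hψd, h3.eventually hφ0, (h3.eventually
      hφ0.eventually_nhds), hSt.eventually hψ] with p h1 h2 h4 h5 h6 hp2
    have h7 : F p = ψ (S p) := by simp only [F, T, hp2]; exact h4
    refine (hline p h1 1).unique ?_
    rw [h7]
    refine h2.congr_of_eventuallyEq ?_
    have h8 : Tendsto (fun s : ℝ => ψ (s, (S p).2)) (𝓝 (p 1)) (𝓝 (ψ (S p))) :=
      h2.continuousAt.tendsto
    filter_upwards [h8.eventually h5] with s hs
    simpa [F, T, S, hp2] using hs
  have hF00 : fderiv ℝ F 0 (E3.basisVec 0) = w := by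
    refine (hline 0 hF.self_of_nhds 0).unique ?_
    have h1 : HasDerivAt (fun s : ℝ => u₀ + s • w) w 0 := by
      simpa using ((hasDerivAt_id (0 : ℝ)).smul_const w).const_add u₀
    refine h1.congr_of_eventuallyEq ?_
    have h2 : Tendsto (fun s : ℝ => u₀ + s • w) (𝓝 0) (𝓝 u₀) := by
      simpa using h1.continuousAt.tendsto
    filter_upwards [h2.eventually hφ0, h2.eventually hψ0] with s h3 h4
    simp [F, T, S, h3, h4]
  have h20 := hF2.self_of_nhds
  have h10 := hF1.self_of_nhds (by simp)
  rw [hF0] at h20 h10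
  have hAF : ∀ᶠ p in 𝓝 0, DifferentiableAt ℝ A (F p) :=
    (hFt.eventually hA).mono fun p h => h.differentiableAt (by simp)
  have hone : ∀ᶠ p in 𝓝 0, A (F p) (fderiv ℝ F p (E3.basisVec 2)) = 1 := by
    filter_upwards [hF2, hFt.eventually hAX] with p h1 h2
    rw [h1, h2]
  -- On z = 0 the derivative of F along `E3.basisVec 1` is Y, which lies in ker A. Away from z = 0
  -- the vanishing persists: the z-derivative equals the y-derivative of the constant A(X) = 1 plus
  -- a value of dA on X, and both are zero.
  have hzero : ∀ᶠ p in 𝓝 0, A (F p) (fderiv ℝ F p (E3.basisVec 1)) = 0 := by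
    refine eventually_eq_zero_of_fderiv_z ?_ ?_
    · filter_upwards [hAF, hF, hF2, hone.eventually_nhds, hFt.eventually hdX] with p h1 h2 h3 h4 h5
      have h2' : ContDiffAt ℝ 2 F p := h2.of_le ENat.LEInfty.out
      refine ⟨(hasFDerivAt_pullback_apply h1 h2' _ (E3.basisVec 2)).1, ?_⟩
      have h6 := fderiv_pullback_sub h1 h2' (E3.basisVec 1) (E3.basisVec 2)
      rw [(show (fun q => A (F q) (fderiv ℝ F q (E3.basisVec 2))) =ᶠ[𝓝 p] fun _ => 1 from
        h4).fderiv_eq, h3, h5] at h6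
      simpa using h6
    · filter_upwards [hF1, hFt.eventually hAY] with p h1 h2 h3
      rw [h1 h3, h2]
  refine ⟨F, hF0, hF, isInvertible_of_injective fun x hx => ?_, hone, hzero, ?_⟩
  · rw [E3.map_eq, hF00, h10, h20] at hx
    -- Pairing with Y through dA kills X and Y and isolates the coefficient x 0 of w; then A
    -- isolates the coefficient x 2 of X; finally Y u₀ ≠ 0 gives x 1 = 0.
    have h1 := congrArg (fun z => fderiv ℝ A u₀ (Y u₀) z - fderiv ℝ A u₀ z (Y u₀)) hx
    have h2 := congrArg (A u₀) hx
    have h3 := hdX.self_of_nhds (Y u₀)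
    simp only [map_add, map_smul, hAY.self_of_nhds, hAX.self_of_nhds, smul_eq_mul, map_zero,
      _root_.add_apply, _root_.smul_apply,
      _root_.zero_apply] at h1 h2
    have h4 : x 0 = 0 := by
      have : x 0 * (fderiv ℝ A u₀ (Y u₀) w - fderiv ℝ A u₀ w (Y u₀)) = 0 := by
        linear_combination h1 + x 2 * h3
      exact (mul_eq_zero.1 this).resolve_right (sub_ne_zero.2 hw)
    have h5 : x 2 = x 0 * (- A u₀ w) := by linear_combination h2
    rw [h4, zero_mul] at h5
    rw [h4, h5] at hx
    have h6 : x 1 = 0 := by simpa [show Y u₀ ≠ 0 from hv] using hx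
    rw [E3.eq_sum x, h4, h5, h6]
    simp
  · have h2' : ContDiffAt ℝ 2 F 0 := hF.self_of_nhds.of_le ENat.LEInfty.out
    have h6 := fderiv_pullback_sub hAF.self_of_nhds h2' (E3.basisVec 0) (E3.basisVec 1)
    rw [(show (fun q => A (F q) (fderiv ℝ F q (E3.basisVec 1))) =ᶠ[𝓝 0] fun _ => 0 from
        hzero).fderiv_eq, hF00, h10, hF0] at h6
    simp only [fderiv_fun_const, Pi.zero_apply, _root_.zero_apply, sub_zero] at h6
    rw [h6]
    exact sub_ne_zero.2 hw

/-- Darboux' theorem for a contact form `A` on `ℝ³` with Reeb field `X`: near every point there are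
coordinates `H = (x, y, z)` with `A = ½ (dz - y dx)`. -/
lemma exists_darboux_coordinates {A : E3 → E3 →L[ℝ] ℝ} {X : E3 → E3} {u₀ : E3}
    (hA : ∀ᶠ u in 𝓝 u₀, ContDiffAt ℝ ∞ A u) (hX : ∀ᶠ u in 𝓝 u₀, ContDiffAt ℝ ∞ X u)
    (hAX : ∀ᶠ u in 𝓝 u₀, A u (X u) = 1)
    (hdX : ∀ᶠ u in 𝓝 u₀, ∀ v, fderiv ℝ A u (X u) v = fderiv ℝ A u v (X u))
    (hnd : ∀ Y, A u₀ Y = 0 → (∀ w, fderiv ℝ A u₀ Y w = fderiv ℝ A u₀ w Y) → Y = 0) :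
    ∃ H : OpenPartialHomeomorph E3 E3, u₀ ∈ H.source ∧ (∀ u ∈ H.source, ContDiffAt ℝ ∞ H u) ∧
      (∀ y ∈ H.target, ContDiffAt ℝ ∞ H.symm y) ∧ ∀ᶠ u in 𝓝 u₀, ∀ v,
        A u v = 1 / 2 * (fderiv ℝ H u v 2 - H u 1 * fderiv ℝ H u v 0) := by
  obtain ⟨F, hF0, hF, hFi, h2, h1, hR⟩ := exists_contact_parametrization hA hX hAX hdX hnd
  obtain ⟨e, he0, he, hes, het⟩ := exists_openPartialHomeomorph_of_isInvertible_fderiv hF hFi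
  have hAF : ∀ᶠ p in 𝓝 0, ContDiffAt ℝ ∞ (fun p => A (F p)) p := by
    have hFt : Tendsto F (𝓝 0) (𝓝 u₀) := by
      have := hF.self_of_nhds.continuousAt.tendsto
      rwa [hF0] at this
    filter_upwards [hF, hFt.eventually hA] with p h3 h4
    exact h4.comp p h3
  let R : E3 → ℝ := fun p => A (F p) (fderiv ℝ F p (E3.basisVec 0))
  have hRs : ∀ᶠ p in 𝓝 0, ContDiffAt ℝ ∞ R p := by
    filter_upwards [hF, hAF] with p h3 h4
    exact h4.clm_apply ((h3.fderiv_right (m := ∞) (by simp)).clm_apply contDiffAt_const)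
  -- The constants are dictated by ½ (d(2z) - (-2R) dx) = dz + R dx; K is invertible at 0 because
  -- ∂R/∂y ≠ 0 there.
  let K : E3 → E3 := fun p => !₂[p 0, -2 * R p, 2 * p 2]
  have hK : ∀ᶠ p in 𝓝 0, ContDiffAt ℝ ∞ K p := by
    filter_upwards [hRs] with p hp
    rw [contDiffAt_piLp]
    intro i
    fin_cases i
    · simp only [K]; simp; fun_prop
    · simp only [K]; simp; fun_prop
    · simp only [K]; simp; fun_prop
  have hKd : ∀ p, ContDiffAt ℝ ∞ K p → ∀ v i, fderiv ℝ K p v i = fderiv ℝ (fun q => K q i) p v := by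
    intro p hp v i
    have h3 := ((EuclideanSpace.proj i : E3 →L[ℝ] ℝ).hasFDerivAt.comp p
      (hp.differentiableAt (by simp)).hasFDerivAt)
    exact (congrArg (fun L : E3 →L[ℝ] ℝ => L v) h3.fderiv).symm
  have hp : ∀ (p : E3) (i : Fin 3) (v : E3), fderiv ℝ (fun q : E3 => q i) p v = v i :=
    fun p i v => congrArg (fun L : E3 →L[ℝ] ℝ => L v)
      (EuclideanSpace.proj i : E3 →L[ℝ] ℝ).hasFDerivAt.fderiv
  have hKd0 : ∀ p, ContDiffAt ℝ ∞ K p → ∀ v, fderiv ℝ K p v 0 = v 0 := by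
    intro p h v
    rw [hKd p h, show (fun q => K q 0) = fun q : E3 => q 0 from by ext; simp [K], hp]
  have hKd2 : ∀ p, ContDiffAt ℝ ∞ K p → ∀ v, fderiv ℝ K p v 2 = 2 * v 2 := by
    intro p h v
    rw [hKd p h, show (fun q => K q 2) = fun q : E3 => 2 * q 2 from by ext; simp [K],
      fderiv_const_mul (by fun_prop)]
    simp [hp]
  have hKd1 : ∀ p, ContDiffAt ℝ ∞ K p → ContDiffAt ℝ ∞ R p → ∀ v,
      fderiv ℝ K p v 1 = -2 * fderiv ℝ R p v := by
    intro p h h' v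
    rw [hKd p h, show (fun q => K q 1) = fun q : E3 => -2 * R q from by ext; simp [K],
      fderiv_const_mul (h'.differentiableAt (by simp))]
    simp
  have hKi : (fderiv ℝ K 0).IsInvertible := by
    refine isInvertible_of_injective fun v hv => ?_
    have h3 := hKd0 0 hK.self_of_nhds v
    have h4 := hKd2 0 hK.self_of_nhds v
    have h5 := hKd1 0 hK.self_of_nhds hRs.self_of_nhds v
    rw [hv] at h3 h4 h5
    simp only [PiLp.zero_apply] at h3 h4 h5
    have h6 : v 2 = 0 := by linarith
    rw [E3.map_eq, ← h3, h6] at h5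
    have h7 : v 1 = 0 := by simpa [R, hR] using h5.symm
    rw [E3.eq_sum v, ← h3, h6, h7]
    simp
  obtain ⟨k, hk0, hk, hks, hkt⟩ := exists_openPartialHomeomorph_of_isInvertible_fderiv hK hKi
  have he0' : e.symm u₀ = 0 := by rw [← hF0, ← he, e.left_inv he0]
  have hu₀ : u₀ ∈ e.target := by rw [← hF0, ← he]; exact e.map_source he0
  have hts : Tendsto e.symm (𝓝 u₀) (𝓝 0) := he0' ▸ (e.continuousAt_symm hu₀).tendsto
  refine ⟨e.symm.trans k, ?_, ?_, ?_, ?_⟩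
  · simp [he0', hk0, hu₀]
  · intro u hu
    rw [OpenPartialHomeomorph.trans_source] at hu
    have := hks _ hu.2
    rw [← hk] at this
    exact this.comp u (het u hu.1)
  · intro y hy
    rw [OpenPartialHomeomorph.trans_target] at hy
    have := hes _ hy.2
    rw [← he] at this
    exact this.comp y (hkt y hy.1)
  · filter_upwards [e.open_target.mem_nhds hu₀, hts.eventually hF, hts.eventually hK,
      hts.eventually h1, hts.eventually h2] with u h3 h4 h5 h6 h7 v
    have h8 : HasFDerivAt e.symm (fderiv ℝ e.symm u) u :=
      ((het u h3).differentiableAt (by simp)).hasFDerivAt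
    have h9 : HasFDerivAt F (fderiv ℝ F (e.symm u)) (e.symm u) :=
      (h4.differentiableAt (by simp)).hasFDerivAt
    have h10 : fderiv ℝ F (e.symm u) (fderiv ℝ e.symm u v) = v := by
      have h11 := (h9.comp u h8).unique ((hasFDerivAt_id u).congr_of_eventuallyEq (by
        filter_upwards [e.open_target.mem_nhds h3] with x hx
        rw [Function.comp_apply, ← he, e.right_inv hx, id]))
      exact congrArg (fun L : E3 →L[ℝ] E3 => L v) h11
    have h12 : fderiv ℝ (e.symm.trans k) u v = fderiv ℝ K (e.symm u) (fderiv ℝ e.symm u v) := by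
      have h13 := ((h5.differentiableAt (by simp)).hasFDerivAt.comp u h8).fderiv
      rw [OpenPartialHomeomorph.coe_trans, hk]
      exact congrArg (fun L : E3 →L[ℝ] E3 => L v) h13
    have h14 : F (e.symm u) = u := by rw [← he, e.right_inv h3]
    rw [h12, hKd0 _ h5, hKd2 _ h5]
    have h15 := E3.map_eq ((A u).comp (fderiv ℝ F (e.symm u))) (fderiv ℝ e.symm u v)
    rw [h14] at h6 h7
    simp only [ContinuousLinearMap.comp_apply, h10, h6, h7, smul_eq_mul] at h15
    rw [h15]
    simp only [OpenPartialHomeomorph.coe_trans, hk, K, R, Function.comp_apply, h14]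
    simp
    ring

end DarbouxTheorem

/-! ### Vector fields with constant components in a chart. -/

section ChartCalculus

variable {M : Type*} [TopologicalSpace M] [ChartedSpace E3 M]
  {e : OpenPartialHomeomorph M E3}

/-- The vector field with constant components `v` in the chart `e`. -/
noncomputable def chartField (e : OpenPartialHomeomorph M E3) (v : E3) (p : M) :
    TangentSpace 𝓘(ℝ, E3) p :=
  VectorField.mpullback 𝓘(ℝ, E3) 𝓘(ℝ, E3) e (fun _ ↦ v) p

lemma chartField_basisVec (e : OpenPartialHomeomorph M E3) (i : Fin 3) :
    chartField e (E3.basisVec i) = coordField e i := rfl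

lemma chartField_add (e : OpenPartialHomeomorph M E3) (v w : E3) (p : M) :
    chartField e (v + w) p = chartField e v p + chartField e w p :=
  map_add (mfderiv 𝓘(ℝ, E3) 𝓘(ℝ, E3) e p).inverse v w

lemma chartField_smul (e : OpenPartialHomeomorph M E3) (c : ℝ) (v : E3) (p : M) :
    chartField e (c • v) p = c • chartField e v p :=
  map_smul (mfderiv 𝓘(ℝ, E3) 𝓘(ℝ, E3) e p).inverse c v

lemma chartField_zero (e : OpenPartialHomeomorph M E3) (p : M) : chartField e 0 p = 0 :=
  map_zero (mfderiv 𝓘(ℝ, E3) 𝓘(ℝ, E3) e p).inverse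

lemma chartField_eq_sum (e : OpenPartialHomeomorph M E3) (v : E3) (p : M) :
    chartField e v p = ∑ i, v i • coordField e i p := by
  conv_lhs => rw [E3.eq_sum v]
  simp only [chartField_add, chartField_smul, chartField_basisVec, Fin.sum_univ_three]

lemma mdifferentiable_of_mem_maximalAtlas (he : e ∈ IsManifold.maximalAtlas 𝓘(ℝ, E3) ∞ M) :
    e.MDifferentiable 𝓘(ℝ, E3) 𝓘(ℝ, E3) :=
  ⟨(contMDiffOn_of_mem_maximalAtlas he).mdifferentiableOn (by simp),
    (contMDiffOn_symm_of_mem_maximalAtlas he).mdifferentiableOn (by simp)⟩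

lemma isInvertible_mfderiv_chart (he : e ∈ IsManifold.maximalAtlas 𝓘(ℝ, E3) ∞ M) {p : M}
    (hp : p ∈ e.source) : (mfderiv 𝓘(ℝ, E3) 𝓘(ℝ, E3) e p).IsInvertible :=
  ⟨(mdifferentiable_of_mem_maximalAtlas he).mfderiv hp, rfl⟩

/-- A smooth function read in a chart is smooth. -/
lemma contDiffAt_comp_chart_symm (he : e ∈ IsManifold.maximalAtlas 𝓘(ℝ, E3) ∞ M)
    {F : Type*} [NormedAddCommGroup F] [NormedSpace ℝ F] {f : M → F} {u : E3} (hu : u ∈ e.target)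
    (hf : ContMDiffAt 𝓘(ℝ, E3) 𝓘(ℝ, F) ∞ f (e.symm u)) : ContDiffAt ℝ ∞ (fun u => f (e.symm u)) u :=
  (hf.comp u (contMDiffAt_symm_of_mem_maximalAtlas he hu)).contDiffAt

lemma mfderiv_chartField (he : e ∈ IsManifold.maximalAtlas 𝓘(ℝ, E3) ∞ M) {p : M}
    (hp : p ∈ e.source) (v : E3) : mfderiv 𝓘(ℝ, E3) 𝓘(ℝ, E3) e p (chartField e v p) = v :=
  (isInvertible_mfderiv_chart he hp).self_apply_inverse v

/-- Every tangent vector has constant components. -/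
lemma exists_chartField_eq (he : e ∈ IsManifold.maximalAtlas 𝓘(ℝ, E3) ∞ M) {p : M}
    (hp : p ∈ e.source) (V : TangentSpace 𝓘(ℝ, E3) p) : ∃ v : E3, chartField e v p = V :=
  ⟨mfderiv 𝓘(ℝ, E3) 𝓘(ℝ, E3) e p V, (isInvertible_mfderiv_chart he hp).inverse_apply_self V⟩

lemma chartField_injective (he : e ∈ IsManifold.maximalAtlas 𝓘(ℝ, E3) ∞ M) {p : M}
    (hp : p ∈ e.source) {v w : E3} (h : chartField e v p = chartField e w p) : v = w := by
  rw [← mfderiv_chartField he hp v, h, mfderiv_chartField he hp]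

/-- The basis of coordinate fields of a tangent space. -/
noncomputable def chartBasis (he : e ∈ IsManifold.maximalAtlas 𝓘(ℝ, E3) ∞ M) {p : M}
    (hp : p ∈ e.source) : Module.Basis (Fin 3) ℝ (TangentSpace 𝓘(ℝ, E3) p) :=
  (EuclideanSpace.basisFun (Fin 3) ℝ).toBasis.map (LinearEquiv.ofBijective
    ({ toFun := fun v => chartField e v p
       map_add' := fun v w => chartField_add e v w p
       map_smul' := fun c v => chartField_smul e c v p } : E3 →ₗ[ℝ] TangentSpace 𝓘(ℝ, E3) p)
    ⟨fun _ _ h => chartField_injective he hp h, exists_chartField_eq he hp⟩)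

lemma chartBasis_apply (he : e ∈ IsManifold.maximalAtlas 𝓘(ℝ, E3) ∞ M) {p : M}
    (hp : p ∈ e.source) (i : Fin 3) : chartBasis he hp i = chartField e (E3.basisVec i) p := by
  simp [chartBasis]
  rfl

lemma chartBasis_repr (he : e ∈ IsManifold.maximalAtlas 𝓘(ℝ, E3) ∞ M) {p : M}
    (hp : p ∈ e.source) (v : E3) (i : Fin 3) :
    (chartBasis he hp).repr (chartField e v p) i = v i := by
  rw [chartField_eq_sum]
  simp only [← chartField_basisVec, ← chartBasis_apply he hp, map_sum, map_smul]
  simp [Finsupp.single_apply]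

/-- Derivative along a chart field of a function on the manifold. -/
lemma mvfderiv_chartField (he : e ∈ IsManifold.maximalAtlas 𝓘(ℝ, E3) ∞ M) {p : M}
    (hp : p ∈ e.source) {f : M → ℝ} {f' : E3 → ℝ} (hf : ∀ u ∈ e.target, f (e.symm u) = f' u)
    (hf' : DifferentiableAt ℝ f' (e p)) (v : E3) :
    mvfderiv 𝓘(ℝ, E3) f p (chartField e v p) = fderiv ℝ f' (e p) v := by
  have h1 : f =ᶠ[𝓝 p] f' ∘ e := by
    filter_upwards [e.open_source.mem_nhds hp] with q hq
    rw [Function.comp_apply, ← hf _ (e.map_source hq), e.left_inv hq]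
  have h2 : mvfderiv 𝓘(ℝ, E3) f p = mvfderiv 𝓘(ℝ, E3) (f' ∘ e) p := by
    ext V
    have := h1.mfderiv_eq (I := 𝓘(ℝ, E3)) (I' := 𝓘(ℝ, ℝ))
    exact congrArg (fun L : E3 →L[ℝ] ℝ => L V) this
  rw [h2, mvfderiv_comp_apply p hf'.mdifferentiableAt
    ((mdifferentiable_of_mem_maximalAtlas he).mdifferentiableAt hp), mfderiv_chartField he hp]
  exact congrArg (fun L : E3 →L[ℝ] ℝ => L v) mfderiv_eq_fderiv

lemma coordDiff_chartField (he : e ∈ IsManifold.maximalAtlas 𝓘(ℝ, E3) ∞ M) {p : M}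
    (hp : p ∈ e.source) (i : Fin 3) (v : E3) : coordDiff e i p (chartField e v p) = v i := by
  have h := mvfderiv_chartField he hp (f := fun q => e q i) (f' := fun u => u i)
    (fun u hu => by rw [e.right_inv hu]) (by fun_prop) v
  refine h.trans ?_
  exact congrArg (fun L : E3 →L[ℝ] ℝ => L v)
      (EuclideanSpace.proj i : E3 →L[ℝ] ℝ).hasFDerivAt.fderiv

variable [IsManifold 𝓘(ℝ, E3) ∞ M]

/-- Smoothness of a vector field at a point. -/
abbrev SmoothFieldAt (X : ∀ p : M, TangentSpace 𝓘(ℝ, E3) p) (p : M) : Prop :=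
  ContMDiffAt 𝓘(ℝ, E3) (𝓘(ℝ, E3).prod 𝓘(ℝ, E3)) ∞ (fun q ↦ Bundle.TotalSpace.mk' E3 q (X q)) p

/-- Differentiability of a vector field at a point. -/
abbrev DiffFieldAt (X : ∀ p : M, TangentSpace 𝓘(ℝ, E3) p) (p : M) : Prop :=
  MDifferentiableAt 𝓘(ℝ, E3) (𝓘(ℝ, E3).prod 𝓘(ℝ, E3))
    (fun q ↦ Bundle.TotalSpace.mk' E3 q (X q)) p

lemma contMDiffAt_chartField (he : e ∈ IsManifold.maximalAtlas 𝓘(ℝ, E3) ∞ M) {p : M}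
    (hp : p ∈ e.source) (v : E3) : SmoothFieldAt (chartField e v) p :=
  ContMDiffAt.mpullback_vectorField_preimage (n := ∞) (V := fun _ => v)
    (contMDiffAt_vectorSpace_iff_contDiffAt.2 contDiffAt_const)
    (contMDiffAt_of_mem_maximalAtlas he hp) (isInvertible_mfderiv_chart he hp) (by simp)

lemma mdifferentiableAt_chartField (he : e ∈ IsManifold.maximalAtlas 𝓘(ℝ, E3) ∞ M) {p : M}
    (hp : p ∈ e.source) (v : E3) : DiffFieldAt (chartField e v) p :=
  (contMDiffAt_chartField he hp v).mdifferentiableAt (by simp)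

/-- The Lie bracket of vector fields in terms of their components in a chart. -/
lemma mlieBracket_chartField_comp (he : e ∈ IsManifold.maximalAtlas 𝓘(ℝ, E3) ∞ M) {p : M}
    (hp : p ∈ e.source) {f k : E3 → E3} (hf : ContDiffAt ℝ 1 f (e p))
    (hk : ContDiffAt ℝ 1 k (e p)) :
    VectorField.mlieBracket 𝓘(ℝ, E3) (fun q => chartField e (f (e q)) q)
      (fun q => chartField e (k (e q)) q) p =
    chartField e (fderiv ℝ k (e p) (f (e p)) - fderiv ℝ f (e p) (k (e p))) p := by
  have : IsManifold 𝓘(ℝ, E3) (minSmoothness ℝ 2) M := IsManifold.of_le (n := ∞) (by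
    simp only [minSmoothness_of_isRCLikeNormedField]
    exact ENat.LEInfty.out)
  -- The map c only retypes a function E3 → E3 as a section of the tangent bundle.
  let c : (E3 → E3) → ∀ x : E3, TangentSpace 𝓘(ℝ, E3) x := fun f => f
  have hc : ∀ f : E3 → E3, ContDiffAt ℝ 1 f (e p) → DiffFieldAt (M := E3) (c f) (e p) :=
    fun f hf => (contMDiffAt_vectorSpace_iff_contDiffAt.2 hf).mdifferentiableAt (by simp)
  have h := VectorField.mpullback_mlieBracket (n := ∞) (hc f hf) (hc k hk)
    (contMDiffAt_of_mem_maximalAtlas he hp) (by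
      simp only [minSmoothness_of_isRCLikeNormedField]
      exact ENat.LEInfty.out)
  refine h.symm.trans ?_
  have h2 : VectorField.mlieBracket 𝓘(ℝ, E3) (c f) (c k) = VectorField.lieBracket ℝ f k := by
    rw [← VectorField.mlieBracketWithin_univ, VectorField.mlieBracketWithin_eq_lieBracketWithin]
    exact VectorField.lieBracketWithin_univ
  rw [h2]
  rfl

/-- Coordinate fields commute. -/
lemma mlieBracket_chartField (he : e ∈ IsManifold.maximalAtlas 𝓘(ℝ, E3) ∞ M) {p : M}
    (hp : p ∈ e.source) (v w : E3) :
    VectorField.mlieBracket 𝓘(ℝ, E3) (chartField e v) (chartField e w) p = 0 := by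
  refine (mlieBracket_chartField_comp he hp (f := fun _ => v) (k := fun _ => w)
    contDiffAt_const contDiffAt_const).trans ?_
  simp [chartField_zero]

/-- A smooth vector field read in a chart is smooth. -/
lemma contDiffAt_components (he : e ∈ IsManifold.maximalAtlas 𝓘(ℝ, E3) ∞ M)
    {X : ∀ p : M, TangentSpace 𝓘(ℝ, E3) p} {u : E3} (hu : u ∈ e.target)
    (hX : SmoothFieldAt X (e.symm u)) :
    ContDiffAt ℝ ∞ (fun u => (mfderiv 𝓘(ℝ, E3) 𝓘(ℝ, E3) e (e.symm u) (X (e.symm u)) : E3)) u := by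
  have hm := mdifferentiable_of_mem_maximalAtlas he
  have h1 := ContMDiffAt.mpullback_vectorField_preimage (n := ∞) (m := ∞) (V := X) (f := e.symm)
    hX (contMDiffAt_symm_of_mem_maximalAtlas he hu) ⟨hm.symm.mfderiv hu, rfl⟩ (by simp)
  refine (contMDiffAt_vectorSpace_iff_contDiffAt.1 h1).congr_of_eventuallyEq ?_
  filter_upwards [e.open_target.mem_nhds hu] with y hy
  rw [VectorField.mpullback_apply]
  exact (congrArg (fun L : E3 →L[ℝ] E3 => L (X (e.symm y)))
    (ContinuousLinearMap.inverse_equiv (hm.symm.mfderiv hy : E3 ≃L[ℝ] E3))).symm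

end ChartCalculus

/-! ### The contact form in a chart and the existence of Darboux charts. -/

namespace AlmostParacontactMetric

variable {M : Type*} [TopologicalSpace M] [ChartedSpace E3 M] [IsManifold 𝓘(ℝ, E3) ∞ M]
  (S : AlmostParacontactMetric E3 M)

lemma contMDiffAt_η {X : ∀ p : M, TangentSpace 𝓘(ℝ, E3) p} {p : M} (hX : SmoothFieldAt X p) :
    ContMDiffAt 𝓘(ℝ, E3) 𝓘(ℝ) ∞ (fun q => S.η q (X q)) p := by
  have : ContMDiffAt 𝓘(ℝ, E3) (𝓘(ℝ, E3).prod 𝓘(ℝ)) ∞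
      (fun m ↦ Bundle.TotalSpace.mk' ℝ (E := Bundle.Trivial M ℝ) m (S.η m (X m))) p :=
    ContMDiffAt.clm_bundle_apply (F₁ := E3) (E₂ := Bundle.Trivial M ℝ) (S.smooth_η p) hX
  simp only [Bundle.contMDiffAt_totalSpace] at this
  exact this.2

lemma contMDiffAt_g {X Y : ∀ p : M, TangentSpace 𝓘(ℝ, E3) p} {p : M} (hX : SmoothFieldAt X p)
    (hY : SmoothFieldAt Y p) :
    ContMDiffAt 𝓘(ℝ, E3) 𝓘(ℝ) ∞ (fun q => S.g q (X q) (Y q)) p := by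
  have : ContMDiffAt 𝓘(ℝ, E3) (𝓘(ℝ, E3).prod 𝓘(ℝ)) ∞
      (fun m ↦ Bundle.TotalSpace.mk' ℝ (E := Bundle.Trivial M ℝ) m (S.g m (X m) (Y m))) p :=
    ContMDiffAt.clm_bundle_apply₂ (F₁ := E3) (F₂ := E3) (E₃ := Bundle.Trivial M ℝ)
      (S.smooth_g p) hX hY
  simp only [Bundle.contMDiffAt_totalSpace] at this
  exact this.2

end AlmostParacontactMetric

namespace AlmostParacontactMetric

variable {M : Type*} [TopologicalSpace M] [ChartedSpace E3 M] [IsManifold 𝓘(ℝ, E3) ∞ M]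
  (S : AlmostParacontactMetric E3 M) {e : OpenPartialHomeomorph M E3}

/-- The `1`-form `η` read in a chart. -/
noncomputable def chartForm (e : OpenPartialHomeomorph M E3) (u : E3) : E3 →L[ℝ] ℝ :=
  ∑ i, S.η (e.symm u) (coordField e i (e.symm u)) • (EuclideanSpace.proj i : E3 →L[ℝ] ℝ)

lemma chartForm_apply (e : OpenPartialHomeomorph M E3) (u v : E3) :
    S.chartForm e u v = S.η (e.symm u) (chartField e v (e.symm u)) := by
  rw [chartField_eq_sum]
  simp [chartForm, Fin.sum_univ_three, mul_comm]

lemma contDiffAt_chartForm (he : e ∈ IsManifold.maximalAtlas 𝓘(ℝ, E3) ∞ M) {u : E3}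
    (hu : u ∈ e.target) : ContDiffAt ℝ ∞ (S.chartForm e) u := by
  refine ContDiffAt.sum fun i _ => ContDiffAt.fun_smul ?_ contDiffAt_const
  exact contDiffAt_comp_chart_symm he hu (f := fun p => S.η p (coordField e i p))
    (S.contMDiffAt_η (contMDiffAt_chartField he (e.map_target hu) (E3.basisVec i)))

/-- Fields with constant components commute, so the bracket term of dη drops out. -/
lemma dη_chartField (he : e ∈ IsManifold.maximalAtlas 𝓘(ℝ, E3) ∞ M) {p : M} (hp : p ∈ e.source)
    (v w : E3) : S.dη (chartField e v) (chartField e w) p =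
      1 / 2 * (fderiv ℝ (S.chartForm e) (e p) v w - fderiv ℝ (S.chartForm e) (e p) w v) := by
  have hA : DifferentiableAt ℝ (S.chartForm e) (e p) :=
    (S.contDiffAt_chartForm he (e.map_source hp)).differentiableAt (by simp)
  have h1 : ∀ v w, mvfderiv 𝓘(ℝ, E3) (fun q ↦ S.η q (chartField e w q)) p (chartField e v p) =
      fderiv ℝ (S.chartForm e) (e p) v w := by
    intro v w
    have h2 := hA.hasFDerivAt.clm_apply (hasFDerivAt_const w (e p))
    rw [mvfderiv_chartField he hp (f' := fun u => S.chartForm e u w)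
      (fun u _ => (S.chartForm_apply e u w).symm) h2.differentiableAt]
    exact (congrArg (fun L : E3 →L[ℝ] ℝ => L v) h2.fderiv).trans (by simp)
  rw [dη, h1, h1, mlieBracket_chartField he hp, map_zero, sub_zero]

variable {S}

lemma g_φ_chartField (hS : S.IsParacontactMetric)
    (he : e ∈ IsManifold.maximalAtlas 𝓘(ℝ, E3) ∞ M) {p : M} (hp : p ∈ e.source) (v w : E3) :
    S.g p (chartField e v p) (S.φ p (chartField e w p)) =
      1 / 2 * (fderiv ℝ (S.chartForm e) (e p) v w - fderiv ℝ (S.chartForm e) (e p) w v) := by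
  rw [← S.dη_chartField he hp]
  exact hS p _ _ (mdifferentiableAt_chartField he hp v) (mdifferentiableAt_chartField he hp w)

/-- Darboux' theorem: the contact form of a paracontact metric `3`-manifold has Darboux coordinates
with convex image around each point. -/
lemma exists_isDarbouxChart (hS : S.IsParacontactMetric) (p : M) :
    ∃ e : OpenPartialHomeomorph M E3,
      IsDarbouxChart S.η e ∧ p ∈ e.source ∧ Convex ℝ e.target := by
  let e₀ := chartAt E3 p
  have he₀ : e₀ ∈ IsManifold.maximalAtlas 𝓘(ℝ, E3) ∞ M := IsManifold.chart_mem_maximalAtlas p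
  have hp : p ∈ e₀.source := mem_chart_source E3 p
  let X : E3 → E3 := fun u => mfderiv 𝓘(ℝ, E3) 𝓘(ℝ, E3) e₀ (e₀.symm u) (S.ξ (e₀.symm u))
  have hXξ : ∀ u ∈ e₀.target, chartField e₀ (X u) (e₀.symm u) = S.ξ (e₀.symm u) := fun u hu =>
    (isInvertible_mfderiv_chart he₀ (e₀.map_target hu)).inverse_apply_self _
  have hnhds : e₀.target ∈ 𝓝 (e₀ p) := e₀.open_target.mem_nhds (e₀.map_source hp)
  obtain ⟨H, hpH, hHs, hHt, hH⟩ := exists_darboux_coordinates (A := S.chartForm e₀) (X := X)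
    (u₀ := e₀ p)
    (by filter_upwards [hnhds] with u hu using S.contDiffAt_chartForm he₀ hu)
    (by filter_upwards [hnhds] with u hu using contDiffAt_components he₀ hu (S.smooth_ξ _))
    (by
      filter_upwards [hnhds] with u hu
      rw [chartForm_apply, hXξ u hu, S.η_ξ])
    (by
      filter_upwards [hnhds] with u hu v
      -- The Reeb condition: dη(v, ξ) = g(v, φξ) = 0.
      have h := g_φ_chartField hS he₀ (e₀.map_target hu) v (X u)
      rw [hXξ u hu, S.φ_ξ, map_zero, e₀.right_inv hu] at h
      linarith)
    (by
      intro Y hY hY'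
      rw [chartForm_apply, e₀.left_inv hp] at hY
      -- Here g(W, φY) = dη(W, Y) = 0 for all W, so φY = 0; as η(Y) = 0, the formula for φ² then
      -- gives Y = 0.
      have h1 : S.φ p (chartField e₀ Y p) = 0 := by
        refine S.g_nondegenerate p _ fun W => ?_
        obtain ⟨w, rfl⟩ := exists_chartField_eq he₀ hp W
        rw [S.g_symm, g_φ_chartField hS he₀ hp, hY' w, sub_self, mul_zero]
      have h2 := S.φ_φ p (chartField e₀ Y p)
      rw [h1, map_zero, hY, zero_smul, sub_zero, ← chartField_zero e₀ p] at h2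
      exact (chartField_injective he₀ hp h2).symm)
  obtain ⟨s, hs, hso, hps⟩ := eventually_nhds_iff.1 hH
  let e₁ := e₀.trans (H.restr s)
  have hp₁ : p ∈ e₁.source := by
    rw [OpenPartialHomeomorph.trans_source, H.restr_source' s hso]
    exact ⟨hp, hpH, hps⟩
  -- Convexity of the image is obtained by cutting the chart down to the preimage of a ball.
  obtain ⟨r, hr, hball⟩ := Metric.isOpen_iff.1 e₁.open_target _ (e₁.map_source hp₁)
  let e := e₁.trans (OpenPartialHomeomorph.ofSet (Metric.ball (e₁ p) r) Metric.isOpen_ball)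
  have hes : e.source ⊆ e₁.source := by
    rw [OpenPartialHomeomorph.trans_source]; exact Set.inter_subset_left
  have hes' : ∀ q ∈ e.source, q ∈ e₀.source ∧ e₀ q ∈ H.source ∧ e₀ q ∈ s := by
    intro q hq
    have h := hes hq
    rw [OpenPartialHomeomorph.trans_source, H.restr_source' s hso] at h
    exact h
  have het : e.target = Metric.ball (e₁ p) r := by
    rw [OpenPartialHomeomorph.trans_target]
    ext y
    simp only [OpenPartialHomeomorph.ofSet_target, OpenPartialHomeomorph.ofSet_symm,
      OpenPartialHomeomorph.ofSet_apply, Set.preimage_id, Set.mem_inter_iff]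
    exact ⟨fun h => h.1, fun h => ⟨h, hball h⟩⟩
  have heat : e ∈ IsManifold.maximalAtlas 𝓘(ℝ, E3) ∞ M := by
    refine OpenPartialHomeomorph.mem_maximalAtlas_of_contMDiffOn _ ?_ ?_
    · intro q hq
      obtain ⟨h1, h2, -⟩ := hes' q hq
      exact ((hHs _ h2).contMDiffAt.comp q (contMDiffAt_of_mem_maximalAtlas he₀ h1)).contMDiffWithinAt
    · intro y hy
      rw [het] at hy
      have h1 := hball hy
      rw [OpenPartialHomeomorph.trans_target] at h1
      have h3 : y ∈ H.target := h1.1.1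
      exact ((contMDiffAt_symm_of_mem_maximalAtlas he₀ h1.2).comp y
        (hHt y h3).contMDiffAt).contMDiffWithinAt
  refine ⟨e, ⟨heat, fun q hq => ?_⟩, ?_, het ▸ convex_ball _ _⟩
  · obtain ⟨h1, h2, h3⟩ := hes' q hq
    have hHd := (hHs _ h2).differentiableAt (by simp)
    have hc : ∀ i v, coordDiff e i q (chartField e₀ v q) = fderiv ℝ H (e₀ q) v i := by
      intro i v
      have h4 := (EuclideanSpace.proj i : E3 →L[ℝ] ℝ).hasFDerivAt.comp (e₀ q) hHd.hasFDerivAt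
      have h5 := mvfderiv_chartField he₀ h1 (f := fun q => e q i) (f' := fun u => H u i)
        (fun u hu => by
          change H (e₀ (e₀.symm u)) i = _
          rw [e₀.right_inv hu]) h4.differentiableAt v
      exact h5.trans (congrArg (fun L : E3 →L[ℝ] ℝ => L v) h4.fderiv)
    ext V
    obtain ⟨v, rfl⟩ := exists_chartField_eq he₀ h1 V
    have h6 := hs _ h3 v
    rw [chartForm_apply, e₀.left_inv h1] at h6
    rw [h6]
    change _ = 1 / 2 * (coordDiff e 2 q _ - e q 1 * coordDiff e 0 q _)
    rw [hc, hc]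
    rfl
  · rw [OpenPartialHomeomorph.trans_source]
    exact ⟨hp₁, Metric.mem_ball_self hr⟩

end AlmostParacontactMetric

/-- A smooth function is independent of `z` exactly when its `z`-derivative vanishes. -/
lemma notDependOnZ_iff {f : E3 → ℝ} {U : Set E3} (hU : IsOpen U)
    (hf : ∀ u ∈ U, DifferentiableAt ℝ f u) : NotDependOnZ f U ↔ ∀ u ∈ U, zDeriv f u = 0 := by
  constructor
  · intro h u hu
    obtain ⟨r, hr, hball⟩ := Metric.isOpen_iff.1 hU u hu
    have h1 : HasDerivAt (fun s : ℝ => f (u + s • E3.basisVec 2)) (zDeriv f u) 0 := by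
      have h2 : HasDerivAt (fun s : ℝ => u + s • E3.basisVec 2) (E3.basisVec 2) 0 := by
        simpa using ((hasDerivAt_id (0 : ℝ)).smul_const (E3.basisVec 2)).const_add u
      have h3 : HasFDerivAt f (fderiv ℝ f u) (u + (0 : ℝ) • E3.basisVec 2) := by
        simpa using (hf u hu).hasFDerivAt
      exact h3.comp_hasDerivAt (0 : ℝ) h2
    refine h1.unique ((hasDerivAt_const (0 : ℝ) (f u)).congr_of_eventuallyEq ?_)
    filter_upwards [Metric.ball_mem_nhds (0 : ℝ) hr] with s hs
    have h4 : u + s • E3.basisVec 2 ∈ Metric.ball u r := by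
      rw [Metric.mem_ball, dist_eq_norm, add_sub_cancel_left, norm_smul]
      simpa using hs
    exact (h u hu _ (hball h4) (by simp) (by simp)
      (((convex_ball u r).segment_subset (Metric.mem_ball_self hr) h4).trans hball)).symm
  · intro h u _ v _ h0 h1 hseg
    refine eq_of_fderiv_segment_eq_zero (fun x hx => hf x (hseg hx)) fun x hx => ?_
    rw [E3.map_eq]
    have h2 : fderiv ℝ f x (E3.basisVec 2) = 0 := h x (hseg hx)
    rw [h2]
    simp [h0, h1]

/-! ### The structure tensors in Darboux coordinates. -/

namespace AlmostParacontactMetric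

variable {M : Type*} [TopologicalSpace M] [ChartedSpace E3 M] [IsManifold 𝓘(ℝ, E3) ∞ M]
  {S : AlmostParacontactMetric E3 M} {e : OpenPartialHomeomorph M E3}

lemma η_chartField (he : IsDarbouxChart S.η e) {p : M} (hp : p ∈ e.source) (v : E3) :
    S.η p (chartField e v p) = 1 / 2 * (v 2 - e p 1 * v 0) := by
  rw [he.2 p hp]
  change 1 / 2 * (coordDiff e 2 p _ - e p 1 * coordDiff e 0 p _) = _
  rw [coordDiff_chartField he.1 hp, coordDiff_chartField he.1 hp]

/-- `4 dη = dx ∧ dy` in Darboux coordinates. -/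
lemma g_φ_chartField_of_isDarbouxChart (hS : S.IsParacontactMetric) (he : IsDarbouxChart S.η e)
    {p : M} (hp : p ∈ e.source) (v w : E3) :
    S.g p (chartField e v p) (S.φ p (chartField e w p)) = 1 / 4 * (v 0 * w 1 - v 1 * w 0) := by
  have hA : DifferentiableAt ℝ (S.chartForm e) (e p) :=
    (S.contDiffAt_chartForm he.1 (e.map_source hp)).differentiableAt (by simp)
  have h1 : ∀ v w, fderiv ℝ (S.chartForm e) (e p) v w = - (1 / 2) * (v 1 * w 0) := by
    intro v w
    have h2 := hA.hasFDerivAt.clm_apply (hasFDerivAt_const w (e p))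
    have h3 : HasFDerivAt (fun u : E3 => 1 / 2 * (w 2 - u 1 * w 0))
        ((-(1 / 2) * w 0) • (EuclideanSpace.proj 1 : E3 →L[ℝ] ℝ)) (e p) := by
      have := ((EuclideanSpace.proj 1 : E3 →L[ℝ] ℝ).hasFDerivAt (x := e p)).const_mul
        (-(1 / 2) * w 0) |>.const_add (1 / 2 * w 2)
      refine this.congr_of_eventuallyEq (.of_forall fun u => ?_)
      simp
      ring
    have h4 := h2.unique (h3.congr_of_eventuallyEq (by
      filter_upwards [e.open_target.mem_nhds (e.map_source hp)] with u hu
      rw [chartForm_apply, η_chartField he (e.map_target hu), e.right_inv hu]))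
    have h5 := congrArg (fun L : E3 →L[ℝ] ℝ => L v) h4
    simp at h5
    rw [h5]
    ring
  rw [g_φ_chartField hS he.1 hp, h1, h1]
  ring

/-- As dη(·, ξ) = 0 and dη is a multiple of dx ∧ dy, ξ has no x or y component; η(ξ) = 1 fixes the
factor 2. -/
lemma ξ_eq (hS : S.IsParacontactMetric) (he : IsDarbouxChart S.η e) {p : M} (hp : p ∈ e.source) :
    S.ξ p = (2 : ℝ) • coordField e 2 p := by
  obtain ⟨w, hw⟩ := exists_chartField_eq he.1 hp (S.ξ p)
  have h : ∀ v : E3, 1 / 4 * (v 0 * w 1 - v 1 * w 0) = 0 := by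
    intro v
    rw [← g_φ_chartField_of_isDarbouxChart hS he hp v w, hw, S.φ_ξ, map_zero]
  have h0 := h (E3.basisVec 0)
  have h1 := h (E3.basisVec 1)
  have h2 := η_chartField he hp w
  rw [hw, S.η_ξ] at h2
  simp at h0 h1
  rw [← hw, chartField_eq_sum, Fin.sum_univ_three, h0, h1]
  rw [h1] at h2
  have : w 2 = 2 := by linarith
  simp [this]

lemma g_ξ (S : AlmostParacontactMetric E3 M) (p : M) (V : TangentSpace 𝓘(ℝ, E3) p) :
    S.g p V (S.ξ p) = S.η p V := by
  have h := S.g_φ_φ p V (S.ξ p)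
  rw [S.φ_ξ, map_zero, S.η_ξ] at h
  linarith

lemma g_coordField_two (hS : S.IsParacontactMetric) (he : IsDarbouxChart S.η e) {p : M}
    (hp : p ∈ e.source) (v : E3) :
    S.g p (chartField e v p) (coordField e 2 p) = 1 / 4 * (v 2 - e p 1 * v 0) := by
  have h := S.g_ξ p (chartField e v p)
  rw [ξ_eq hS he hp, map_smul, η_chartField he hp, smul_eq_mul] at h
  linarith

/-- Four times a coefficient of the metric in a chart. -/
noncomputable def metricCoeff (S : AlmostParacontactMetric E3 M) (e : OpenPartialHomeomorph M E3)
    (i j : Fin 3) (u : E3) : ℝ :=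
  4 * S.g (e.symm u) (coordField e i (e.symm u)) (coordField e j (e.symm u))

lemma contDiffAt_metricCoeff (S : AlmostParacontactMetric E3 M)
    (he : e ∈ IsManifold.maximalAtlas 𝓘(ℝ, E3) ∞ M) (i j : Fin 3)
    {u : E3} (hu : u ∈ e.target) : ContDiffAt ℝ ∞ (S.metricCoeff e i j) u := by
  refine contDiffAt_const.mul ?_
  exact contDiffAt_comp_chart_symm he hu
    (f := fun p => S.g p (coordField e i p) (coordField e j p))
    (S.contMDiffAt_g (contMDiffAt_chartField he (e.map_target hu) (E3.basisVec i))
      (contMDiffAt_chartField he (e.map_target hu) (E3.basisVec j)))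

lemma g_coordField (S : AlmostParacontactMetric E3 M) {p : M} (hp : p ∈ e.source) (i j : Fin 3) :
    S.g p (coordField e i p) (coordField e j p) = 1 / 4 * S.metricCoeff e i j (e p) := by
  rw [metricCoeff, e.left_inv hp]
  ring

/-- The components of `φ v`, where `a`, `b`, `c`, `y` are values at a point. -/
noncomputable def phiVec (a b c y : ℝ) (v : E3) : E3 :=
  !₂[-b * v 0 - c * v 1, (a - y ^ 2) * v 0 + b * v 1, y * (-b * v 0 - c * v 1)]

/-- The form of `φ` in Darboux coordinates, with the relation between the coefficients. -/
lemma darboux_form (hS : S.IsParacontactMetric) (he : IsDarbouxChart S.η e) {p : M}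
    (hp : p ∈ e.source) {a b c y : ℝ} (ha : S.metricCoeff e 0 0 (e p) = a)
    (hb : S.metricCoeff e 0 1 (e p) = b) (hc : S.metricCoeff e 1 1 (e p) = c) (hy : e p 1 = y) :
    a * c - b ^ 2 - c * y ^ 2 = -1 ∧
      ∀ v, S.φ p (chartField e v p) = chartField e (phiVec a b c y v) p := by
  have hg00 := S.g_coordField hp 0 0
  have hg01 := S.g_coordField hp 0 1
  have hg11 := S.g_coordField hp 1 1
  rw [ha] at hg00
  rw [hb] at hg01
  rw [hc] at hg11
  have hg10 := hg01
  rw [S.g_symm] at hg10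
  have hg2 : ∀ i, S.g p (coordField e i p) (coordField e 2 p) =
      1 / 4 * (E3.basisVec i 2 - y * E3.basisVec i 0) := by
    intro i
    rw [← chartField_basisVec, g_coordField_two hS he hp, hy]
  -- The components s of φw satisfy three linear equations: η(φw) = 0 gives the z-component, and
  -- pairing φw with ∂_x and ∂_y through g gives the other two.
  have key : ∀ w : E3, ∃ s : E3, S.φ p (chartField e w p) = chartField e s p ∧ s 2 = y * s 0 ∧
      (a - y ^ 2) * s 0 + b * s 1 = w 1 ∧ b * s 0 + c * s 1 = - w 0 := by
    intro w
    obtain ⟨s, hs⟩ := exists_chartField_eq he.1 hp (S.φ p (chartField e w p))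
    have h1 := η_chartField he hp s
    rw [hs, S.η_φ, hy] at h1
    have h2 : s 2 = y * s 0 := by linarith
    have h3 := g_φ_chartField_of_isDarbouxChart hS he hp (E3.basisVec 0) w
    have h4 := g_φ_chartField_of_isDarbouxChart hS he hp (E3.basisVec 1) w
    rw [← hs, chartField_eq_sum e s, chartField_basisVec] at h3 h4
    simp only [Fin.sum_univ_three, map_add, map_smul, hg00, hg01, hg10, hg11, hg2, smul_eq_mul]
      at h3 h4
    simp at h3 h4
    refine ⟨s, hs.symm, h2, ?_, ?_⟩
    · rw [h2] at h3
      linear_combination 4 * h3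
    · linear_combination 4 * h4
  obtain ⟨s, hs, hs2, hs3, hs4⟩ := key (E3.basisVec 0)
  obtain ⟨t, ht, ht2, ht3, ht4⟩ := key (E3.basisVec 1)
  have hφ2 : S.φ p (coordField e 2 p) = 0 := by
    have h := S.φ_ξ p
    rw [ξ_eq hS he hp, map_smul] at h
    exact (smul_eq_zero.1 h).resolve_left two_ne_zero
  rw [chartField_basisVec] at hs ht
  -- This is the x-component of φ²∂_x = ∂_x - η(∂_x) ξ, to which ξ contributes nothing.
  have hsq : s 0 * s 0 + s 1 * t 0 = 1 := by
    have h := S.φ_φ p (coordField e 0 p)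
    have h1 := η_chartField he hp (E3.basisVec 0)
    rw [chartField_basisVec] at h1
    rw [hs, h1, ξ_eq hS he hp, chartField_eq_sum e s] at h
    simp only [Fin.sum_univ_three, map_add, map_smul, hφ2, hs, ht] at h
    simp only [← chartField_basisVec, ← chartField_smul, ← chartField_add, smul_zero, add_zero,
      eq_sub_iff_add_eq] at h
    have h2 := congrFun (congrArg WithLp.ofLp (chartField_injective he.1 hp h)) 0
    simpa using h2
  simp at hs3 hs4 ht3 ht4
  set α := a - y ^ 2 with hα
  have h1 : (α * c - b ^ 2) * s 0 = b := by linear_combination c * hs3 - b * hs4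
  have h2 : (α * c - b ^ 2) * s 1 = -α := by linear_combination α * hs4 - b * hs3
  have h3 : (α * c - b ^ 2) * t 0 = c := by linear_combination c * ht3 - b * ht4
  have h4 : (α * c - b ^ 2) * t 1 = -b := by linear_combination α * ht4 - b * ht3
  have hD : α * c - b ^ 2 = -1 := by
    -- With D = αc - b², Cramer's formulas turn D² times `hsq` into b² - αc = D², that is D(D + 1) =
    -- 0. The case D = 0 would force b = c = 0, against `hs4`.
    have h5 : (α * c - b ^ 2) * (α * c - b ^ 2 + 1) = 0 := by
      linear_combination (α * c - b ^ 2) ^ 2 * (-hsq) + ((α * c - b ^ 2) * s 0 + b) * h1 +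
        ((α * c - b ^ 2) * t 0) * h2 - α * h3
    rcases mul_eq_zero.1 h5 with h6 | h6
    · rw [h6, zero_mul] at h1 h3
      rw [← h1, ← h3] at hs4
      simp at hs4
    · linarith
  rw [hD] at h1 h2 h3 h4
  refine ⟨by rw [← hD, hα]; ring, fun v => ?_⟩
  rw [chartField_eq_sum e v]
  simp only [Fin.sum_univ_three, map_add, map_smul, hφ2, hs, ht]
  simp only [← chartField_smul, ← chartField_add, smul_zero, add_zero]
  congr 1
  have h1' : s 0 = -b := by linarith
  have h2' : s 1 = α := by linarith
  have h3' : t 0 = -c := by linarith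
  have h4' : t 1 = b := by linarith
  ext i
  fin_cases i
  · simp [phiVec, h1', h3']; ring
  · simp [phiVec, h2', h4', hα]; ring
  · simp [phiVec, hs2, ht2, h1', h3']; ring

end AlmostParacontactMetric

/-! ### Derivatives of the components of φ, and the tensor h. -/

lemma E3.fderiv_apply {f : E3 → E3} {u : E3} (hf : DifferentiableAt ℝ f u) (w : E3) (i : Fin 3) :
    fderiv ℝ f u w i = fderiv ℝ (fun x => f x i) u w :=
  (congrArg (fun L : E3 →L[ℝ] ℝ => L w)
    ((EuclideanSpace.proj i : E3 →L[ℝ] ℝ).hasFDerivAt.comp u hf.hasFDerivAt).fderiv).symm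

lemma E3.hasFDerivAt_coord (i : Fin 3) (u : E3) :
    HasFDerivAt (fun x : E3 => x i) (EuclideanSpace.proj i : E3 →L[ℝ] ℝ) u :=
  (EuclideanSpace.proj i : E3 →L[ℝ] ℝ).hasFDerivAt

lemma contDiffAt_phiVec {a b c : E3 → ℝ} {u : E3} (ha : ContDiffAt ℝ ∞ a u)
    (hb : ContDiffAt ℝ ∞ b u) (hc : ContDiffAt ℝ ∞ c u) (v : E3) :
    ContDiffAt ℝ ∞ (fun x => AlmostParacontactMetric.phiVec (a x) (b x) (c x) (x 1) v) u := by
  rw [contDiffAt_piLp]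
  intro i
  fin_cases i
  · simp only [AlmostParacontactMetric.phiVec]; simp; fun_prop
  · simp only [AlmostParacontactMetric.phiVec]; simp; fun_prop
  · simp only [AlmostParacontactMetric.phiVec]; simp; fun_prop

lemma fderiv_phiVec {a b c : E3 → ℝ} {u : E3} (ha : ContDiffAt ℝ ∞ a u)
    (hb : ContDiffAt ℝ ∞ b u) (hc : ContDiffAt ℝ ∞ c u) (v w : E3) :
    fderiv ℝ (fun x => AlmostParacontactMetric.phiVec (a x) (b x) (c x) (x 1) v) u w =
      !₂[-fderiv ℝ b u w * v 0 - fderiv ℝ c u w * v 1,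
        (fderiv ℝ a u w - 2 * u 1 * w 1) * v 0 + fderiv ℝ b u w * v 1,
        w 1 * (-b u * v 0 - c u * v 1) +
          u 1 * (-fderiv ℝ b u w * v 0 - fderiv ℝ c u w * v 1)] := by
  have ha' := (ha.differentiableAt (by simp)).hasFDerivAt
  have hb' := (hb.differentiableAt (by simp)).hasFDerivAt
  have hc' := (hc.differentiableAt (by simp)).hasFDerivAt
  have hy := E3.hasFDerivAt_coord 1 u
  have h0 := (hb'.neg.mul_const (v 0)).sub (hc'.mul_const (v 1))
  have h1 := ((ha'.sub (hy.pow 2)).mul_const (v 0)).add (hb'.mul_const (v 1))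
  have h2 := hy.mul h0
  have hd := (contDiffAt_phiVec ha hb hc v).differentiableAt (by simp)
  ext i
  rw [E3.fderiv_apply hd]
  fin_cases i
  · refine (congrArg (fun L : E3 →L[ℝ] ℝ => L w) h0.fderiv).trans ?_
    simp; ring
  · refine (congrArg (fun L : E3 →L[ℝ] ℝ => L w) h1.fderiv).trans ?_
    simp; ring
  · refine (congrArg (fun L : E3 →L[ℝ] ℝ => L w) h2.fderiv).trans ?_
    simp; ring

namespace AlmostParacontactMetric

variable {M : Type*} [TopologicalSpace M] [ChartedSpace E3 M] [IsManifold 𝓘(ℝ, E3) ∞ M]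
  {S : AlmostParacontactMetric E3 M} {e : OpenPartialHomeomorph M E3}

/-- The components of `φ v` in a Darboux chart. -/
noncomputable def phiField (S : AlmostParacontactMetric E3 M) (e : OpenPartialHomeomorph M E3)
    (v u : E3) : E3 :=
  phiVec (S.metricCoeff e 0 0 u) (S.metricCoeff e 0 1 u) (S.metricCoeff e 1 1 u) (u 1) v

lemma φ_chartField (hS : S.IsParacontactMetric) (he : IsDarbouxChart S.η e) {p : M}
    (hp : p ∈ e.source) (v : E3) :
    S.φ p (chartField e v p) = chartField e (S.phiField e v (e p)) p :=
  (darboux_form hS he hp rfl rfl rfl rfl).2 v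

lemma contDiffAt_phiField (S : AlmostParacontactMetric E3 M)
    (he : e ∈ IsManifold.maximalAtlas 𝓘(ℝ, E3) ∞ M) {u : E3}
    (hu : u ∈ e.target) (v : E3) : ContDiffAt ℝ ∞ (S.phiField e v) u :=
  contDiffAt_phiVec (S.contDiffAt_metricCoeff he 0 0 hu) (S.contDiffAt_metricCoeff he 0 1 hu)
    (S.contDiffAt_metricCoeff he 1 1 hu) v

lemma fderiv_phiField (S : AlmostParacontactMetric E3 M)
    (he : e ∈ IsManifold.maximalAtlas 𝓘(ℝ, E3) ∞ M) {u : E3}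
    (hu : u ∈ e.target) (v w : E3) : fderiv ℝ (S.phiField e v) u w =
      !₂[-fderiv ℝ (S.metricCoeff e 0 1) u w * v 0 - fderiv ℝ (S.metricCoeff e 1 1) u w * v 1,
        (fderiv ℝ (S.metricCoeff e 0 0) u w - 2 * u 1 * w 1) * v 0 +
          fderiv ℝ (S.metricCoeff e 0 1) u w * v 1,
        w 1 * (-S.metricCoeff e 0 1 u * v 0 - S.metricCoeff e 1 1 u * v 1) +
          u 1 * (-fderiv ℝ (S.metricCoeff e 0 1) u w * v 0 -
            fderiv ℝ (S.metricCoeff e 1 1) u w * v 1)] :=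
  fderiv_phiVec (S.contDiffAt_metricCoeff he 0 0 hu) (S.contDiffAt_metricCoeff he 0 1 hu)
    (S.contDiffAt_metricCoeff he 1 1 hu) v w

lemma φ_chartField_eventuallyEq (hS : S.IsParacontactMetric) (he : IsDarbouxChart S.η e) {p : M}
    (hp : p ∈ e.source) (v : E3) :
    (fun q => S.φ q (chartField e v q)) =ᶠ[𝓝 p] fun q => chartField e (S.phiField e v (e q)) q := by
  filter_upwards [e.open_source.mem_nhds hp] with q hq using φ_chartField hS he hq v

lemma mlieBracket_chartField_φ (hS : S.IsParacontactMetric) (he : IsDarbouxChart S.η e) {p : M}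
    (hp : p ∈ e.source) (v w : E3) :
    VectorField.mlieBracket 𝓘(ℝ, E3) (chartField e w) (fun q => S.φ q (chartField e v q)) p =
      chartField e (fderiv ℝ (S.phiField e v) (e p) w) p := by
  rw [Filter.EventuallyEq.mlieBracket_vectorField_eq (EventuallyEq.refl _ (chartField e w))
    (φ_chartField_eventuallyEq hS he hp v)]
  refine (mlieBracket_chartField_comp he.1 hp (f := fun _ => w) (k := S.phiField e v)
    contDiffAt_const ((S.contDiffAt_phiField he.1 (e.map_source hp) v).of_le
      ENat.LEInfty.out)).trans ?_
  simp

lemma mlieBracket_φ_φ (hS : S.IsParacontactMetric) (he : IsDarbouxChart S.η e) {p : M}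
    (hp : p ∈ e.source) (v w : E3) :
    VectorField.mlieBracket 𝓘(ℝ, E3) (fun q => S.φ q (chartField e v q))
        (fun q => S.φ q (chartField e w q)) p =
      chartField e (fderiv ℝ (S.phiField e w) (e p) (S.phiField e v (e p)) -
        fderiv ℝ (S.phiField e v) (e p) (S.phiField e w (e p))) p := by
  rw [Filter.EventuallyEq.mlieBracket_vectorField_eq (φ_chartField_eventuallyEq hS he hp v)
    (φ_chartField_eventuallyEq hS he hp w)]
  exact mlieBracket_chartField_comp he.1 hp
    ((S.contDiffAt_phiField he.1 (e.map_source hp) v).of_le ENat.LEInfty.out)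
    ((S.contDiffAt_phiField he.1 (e.map_source hp) w).of_le ENat.LEInfty.out)

/-- The components of `h v` are the derivatives of those of `φ v` along `∂/∂z`. -/
lemma h_chartField (hS : S.IsParacontactMetric) (he : IsDarbouxChart S.η e) {p : M}
    (hp : p ∈ e.source) (v : E3) :
    S.h p (chartField e v p) =
      chartField e (fderiv ℝ (S.phiField e v) (e p) (E3.basisVec 2)) p := by
  -- Near p the field ξ has constant components, so [ξ, v] = 0 for constant v, and the factor 2
  -- cancels the ½ in h.
  have hξ : S.ξ =ᶠ[𝓝 p] chartField e ((2 : ℝ) • E3.basisVec 2) := by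
    filter_upwards [e.open_source.mem_nhds hp] with q hq
    rw [ξ_eq hS he hq, chartField_smul, chartField_basisVec]
  rw [S.h_apply p (mdifferentiableAt_chartField he.1 hp v), lieDerivφ,
    Filter.EventuallyEq.mlieBracket_vectorField_eq hξ
      (EventuallyEq.refl _ fun q => S.φ q (chartField e v q)),
    Filter.EventuallyEq.mlieBracket_vectorField_eq hξ (EventuallyEq.refl _ (chartField e v)),
    mlieBracket_chartField he.1 hp, mlieBracket_chartField_φ hS he hp, map_zero, sub_zero,
    map_smul, chartField_smul, smul_smul]
  norm_num

/-- `h²` in a Darboux chart. -/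
lemma h_h_chartField (hS : S.IsParacontactMetric) (he : IsDarbouxChart S.η e) {p : M}
    (hp : p ∈ e.source) (v : E3) :
    S.h p (S.h p (chartField e v p)) =
      (zDeriv (S.metricCoeff e 0 1) (e p) ^ 2 -
        zDeriv (S.metricCoeff e 0 0) (e p) * zDeriv (S.metricCoeff e 1 1) (e p)) •
        chartField e (!₂[v 0, v 1, e p 1 * v 0]) p := by
  rw [h_chartField hS he hp, h_chartField hS he hp, ← chartField_smul,
    S.fderiv_phiField he.1 (e.map_source hp), S.fderiv_phiField he.1 (e.map_source hp)]
  -- The (x, y) block of h has rows (-b_z, -c_z) and (a_z, b_z); being traceless, it squares to b_z²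
  -- - a_z c_z times the identity. The z-component of hv is y times its x-component.
  congr 1
  ext i
  fin_cases i
  · simp [zDeriv]; ring
  · simp [zDeriv]; ring
  · simp [zDeriv]; ring

/-- The diagonal entries of h² along ∂_x and ∂_y are both b_z² - a_z c_z, and h²∂_z = 0. The trace
thus detects the only scalar on which h² depends. -/
lemma trace_h_h (hS : S.IsParacontactMetric) (he : IsDarbouxChart S.η e) {p : M}
    (hp : p ∈ e.source) :
    LinearMap.trace ℝ (TangentSpace 𝓘(ℝ, E3) p) (S.h p ∘L S.h p).toLinearMap =
      2 * (zDeriv (S.metricCoeff e 0 1) (e p) ^ 2 -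
        zDeriv (S.metricCoeff e 0 0) (e p) * zDeriv (S.metricCoeff e 1 1) (e p)) := by
  rw [LinearMap.trace_eq_matrix_trace ℝ (chartBasis he.1 hp), Matrix.trace_fin_three]
  simp only [LinearMap.toMatrix_apply, chartBasis_apply]
  have h : ∀ v, (S.h p ∘L S.h p).toLinearMap (chartField e v p) = S.h p (S.h p (chartField e v p)) :=
    fun _ => rfl
  simp only [h, h_h_chartField hS he hp, ← chartField_smul, chartBasis_repr]
  simp
  ring

lemma h_h_eq_zero_iff (hS : S.IsParacontactMetric) (he : IsDarbouxChart S.η e) {p : M}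
    (hp : p ∈ e.source) : S.h p ∘L S.h p = 0 ↔ zDeriv (S.metricCoeff e 0 1) (e p) ^ 2 -
        zDeriv (S.metricCoeff e 0 0) (e p) * zDeriv (S.metricCoeff e 1 1) (e p) = 0 := by
  constructor
  · intro h
    have h1 := trace_h_h hS he hp
    rw [h] at h1
    simpa using h1.symm
  · intro h
    ext V
    obtain ⟨v, rfl⟩ := exists_chartField_eq he.1 hp V
    change S.h p (S.h p (chartField e v p)) = 0
    rw [h_h_chartField hS he hp, h, zero_smul]

end AlmostParacontactMetric

/-! ### The Nijenhuis torsion and normality. -/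

namespace AlmostParacontactMetric

variable {M : Type*} [TopologicalSpace M] [ChartedSpace E3 M] [IsManifold 𝓘(ℝ, E3) ∞ M]
  {S : AlmostParacontactMetric E3 M} {e : OpenPartialHomeomorph M E3}

/-- The Nijenhuis torsion is tensorial in its second argument. -/
lemma tensorialAt_nijenhuis (S : AlmostParacontactMetric E3 M)
    (X : ∀ q : M, TangentSpace 𝓘(ℝ, E3) q) (p : M) :
    TensorialAt 𝓘(ℝ, E3) E3 (S.nijenhuis X · p) p := by
  have : IsManifold 𝓘(ℝ, E3) (minSmoothness ℝ 2) M := IsManifold.of_le (n := ∞) (by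
    simp only [minSmoothness_of_isRCLikeNormedField]
    exact ENat.LEInfty.out)
  constructor
  · intro f Y hf hY
    have h1 : (fun q ↦ S.φ q ((f • Y) q)) = f • (fun q ↦ S.φ q (Y q)) := by
      ext q; simp
    simp only [nijenhuis]
    rw [h1, VectorField.mlieBracket_smul_right hf (S.mdiffAt_φ hY),
      VectorField.mlieBracket_smul_right hf (S.mdiffAt_φ hY),
      VectorField.mlieBracket_smul_right hf hY, VectorField.mlieBracket_smul_right hf hY]
    simp only [map_add, map_smul, smul_add, smul_sub]
    abel
  · intro Y Z hY hZ
    have h1 : (fun q ↦ S.φ q ((Y + Z) q)) = (fun q ↦ S.φ q (Y q)) + (fun q ↦ S.φ q (Z q)) := by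
      ext q; simp
    simp only [nijenhuis]
    rw [h1, VectorField.mlieBracket_add_right (S.mdiffAt_φ hY) (S.mdiffAt_φ hZ),
      VectorField.mlieBracket_add_right (S.mdiffAt_φ hY) (S.mdiffAt_φ hZ),
      VectorField.mlieBracket_add_right hY hZ, VectorField.mlieBracket_add_right hY hZ]
    simp only [map_add]
    abel

lemma nijenhuis_swap (S : AlmostParacontactMetric E3 M)
    (X Y : ∀ q : M, TangentSpace 𝓘(ℝ, E3) q) (p : M) :
    S.nijenhuis X Y p = - S.nijenhuis Y X p := by
  simp only [nijenhuis]
  rw [VectorField.mlieBracket_swap_apply (V := X) (W := Y),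
    VectorField.mlieBracket_swap_apply (V := fun q ↦ S.φ q (X q)),
    VectorField.mlieBracket_swap_apply (V := fun q ↦ S.φ q (X q)) (W := Y),
    VectorField.mlieBracket_swap_apply (V := X)]
  simp only [map_neg]
  abel

/-- Antisymmetry transfers tensoriality to the first argument. Normality, which concerns arbitrary
differentiable fields, can then be tested on fields with constant components. -/
lemma nijenhuis_congr (S : AlmostParacontactMetric E3 M)
    {X X' Y Y' : ∀ q : M, TangentSpace 𝓘(ℝ, E3) q} {p : M} (hX : DiffFieldAt X p)
    (hX' : DiffFieldAt X' p) (hY : DiffFieldAt Y p) (hY' : DiffFieldAt Y' p)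
    (h : X p = X' p) (h' : Y p = Y' p) : S.nijenhuis X Y p = S.nijenhuis X' Y' p := by
  rw [(S.tensorialAt_nijenhuis X p).pointwise hY hY' h', S.nijenhuis_swap X,
    (S.tensorialAt_nijenhuis Y' p).pointwise hX hX' h, ← S.nijenhuis_swap X']

/-- The Nijenhuis torsion on coordinate fields of a Darboux chart. -/
lemma nijenhuis_chartField (hS : S.IsParacontactMetric) (he : IsDarbouxChart S.η e) {p : M}
    (hp : p ∈ e.source) (v w : E3) :
    S.nijenhuis (chartField e v) (chartField e w) p = chartField e
      (fderiv ℝ (S.phiField e w) (e p) (S.phiField e v (e p)) -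
        fderiv ℝ (S.phiField e v) (e p) (S.phiField e w (e p)) +
        S.phiField e (fderiv ℝ (S.phiField e v) (e p) w) (e p) -
        S.phiField e (fderiv ℝ (S.phiField e w) (e p) v) (e p)) p := by
  have hsub : ∀ v w, chartField e (v - w) p = chartField e v p - chartField e w p := by
    intro v w
    rw [eq_sub_iff_add_eq, ← chartField_add, sub_add_cancel]
  rw [nijenhuis, mlieBracket_φ_φ hS he hp, mlieBracket_chartField he.1 hp,
    mlieBracket_chartField_φ hS he hp,
    VectorField.mlieBracket_swap_apply (V := fun q ↦ S.φ q (chartField e v q)),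
    mlieBracket_chartField_φ hS he hp, map_neg, φ_chartField hS he hp, φ_chartField hS he hp,
    hsub, hsub, chartField_add, hsub]
  simp

/-- The differentiated relation between the metric coefficients in Darboux coordinates. -/
lemma fderiv_relation (hS : S.IsParacontactMetric) (he : IsDarbouxChart S.η e) {u : E3}
    (hu : u ∈ e.target) (w : E3) :
    fderiv ℝ (S.metricCoeff e 0 0) u w * S.metricCoeff e 1 1 u +
      S.metricCoeff e 0 0 u * fderiv ℝ (S.metricCoeff e 1 1) u w -
      2 * S.metricCoeff e 0 1 u * fderiv ℝ (S.metricCoeff e 0 1) u w -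
      fderiv ℝ (S.metricCoeff e 1 1) u w * u 1 ^ 2 -
      2 * S.metricCoeff e 1 1 u * u 1 * w 1 = 0 := by
  have hd : ∀ i j, HasFDerivAt (S.metricCoeff e i j) (fderiv ℝ (S.metricCoeff e i j) u) u :=
    fun i j => ((S.contDiffAt_metricCoeff he.1 i j hu).differentiableAt (by simp)).hasFDerivAt
  have h1 := (((hd 0 0).mul (hd 1 1)).sub ((hd 0 1).pow 2)).sub
    ((hd 1 1).mul ((E3.hasFDerivAt_coord 1 u).pow 2))
  have h2 := h1.unique ((hasFDerivAt_const (-1 : ℝ) u).congr_of_eventuallyEq (by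
    filter_upwards [e.open_target.mem_nhds hu] with x hx
    have h3 := (darboux_form hS he (e.map_target hx) rfl rfl rfl rfl).1
    rw [e.right_inv hx] at h3
    exact h3))
  have h4 := congrArg (fun L : E3 →L[ℝ] ℝ => L w) h2
  simp at h4
  linear_combination h4

lemma phiField_basisVec_two (S : AlmostParacontactMetric E3 M) (e : OpenPartialHomeomorph M E3) :
    S.phiField e (E3.basisVec 2) = fun _ => 0 := by
  ext u i
  fin_cases i <;> simp [phiField, phiVec]

lemma phiField_zero (S : AlmostParacontactMetric E3 M) (e : OpenPartialHomeomorph M E3) (u : E3) :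
    S.phiField e 0 u = 0 := by
  ext i
  fin_cases i <;> simp [phiField, phiVec]

/-- Normality is tested on the pairs (v, ∂_z). Since φ∂_z = 0 and dη(v, ∂_z) = 0, only φ(hv) = 0
remains. The (x, y) block of φ has determinant -1, so the x and y components of hv vanish; v = ∂_x
and v = ∂_y give the three derivatives. -/
lemma zDeriv_eq_zero_of_isNormalOn (hS : S.IsParacontactMetric) (he : IsDarbouxChart S.η e)
    (h : S.IsNormalOn e.source) {u : E3} (hu : u ∈ e.target) :
    zDeriv (S.metricCoeff e 0 0) u = 0 ∧
      zDeriv (S.metricCoeff e 0 1) u = 0 ∧ zDeriv (S.metricCoeff e 1 1) u = 0 := by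
  have hp := e.map_target hu
  have hrel := (darboux_form hS he hp rfl rfl rfl rfl).1
  rw [e.right_inv hu] at hrel
  have hz : ∀ v : E3, fderiv ℝ (S.phiField e v) u (E3.basisVec 2) 0 = 0 ∧
      fderiv ℝ (S.phiField e v) u (E3.basisVec 2) 1 = 0 := by
    intro v
    have h1 := h _ hp (chartField e v) (chartField e (E3.basisVec 2))
      (mdifferentiableAt_chartField he.1 hp _) (mdifferentiableAt_chartField he.1 hp _)
    have h2 := hS _ (chartField e v) (chartField e (E3.basisVec 2))
      (mdifferentiableAt_chartField he.1 hp _) (mdifferentiableAt_chartField he.1 hp _)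
    rw [g_φ_chartField_of_isDarbouxChart hS he hp,
      show (1 : ℝ) / 4 * (v 0 * E3.basisVec 2 1 - v 1 * E3.basisVec 2 0) = 0 by simp] at h2
    rw [nijenhuis_chartField hS he hp, ← h2, e.right_inv hu, phiField_basisVec_two, mul_zero, zero_smul,
      sub_zero] at h1
    simp only [fderiv_fun_const, Pi.zero_apply, zero_apply, map_zero, phiField_zero, sub_zero,
      zero_add] at h1
    rw [← chartField_zero e] at h1
    have h3 := chartField_injective he.1 hp h1
    set d := fderiv ℝ (S.phiField e v) u (E3.basisVec 2)
    have h4 := congrArg (fun x : E3 => x 0) h3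
    have h5 := congrArg (fun x : E3 => x 1) h3
    simp [phiField, phiVec] at h4 h5
    constructor
    · linear_combination d 0 * hrel - S.metricCoeff e 1 1 u * h5 -
        S.metricCoeff e 0 1 u * h4
    · linear_combination d 1 * hrel + S.metricCoeff e 0 1 u * h5 +
        (S.metricCoeff e 0 0 u - u 1 ^ 2) * h4
  have h0 := hz (E3.basisVec 0)
  have h1 := hz (E3.basisVec 1)
  rw [S.fderiv_phiField he.1 hu] at h0 h1
  simp at h0 h1
  exact ⟨h0.2, h0.1, h1.1⟩

/-- Every component of the tensor on (v, w) is a multiple of v₀w₁ - v₁w₀. The x-component is the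
determinant relation differentiated in y, the y-component is the relation differentiated in x, and
in the z-component the relation itself cancels the term 2 dη ⊗ ξ. -/
lemma isNormalOn_of_zDeriv_eq_zero (hS : S.IsParacontactMetric) (he : IsDarbouxChart S.η e)
    (h : ∀ u ∈ e.target, zDeriv (S.metricCoeff e 0 0) u = 0 ∧
      zDeriv (S.metricCoeff e 0 1) u = 0 ∧ zDeriv (S.metricCoeff e 1 1) u = 0) :
    S.IsNormalOn e.source := by
  intro p hp X Y hX hY
  obtain ⟨v, hv⟩ := exists_chartField_eq he.1 hp (X p)
  obtain ⟨w, hw⟩ := exists_chartField_eq he.1 hp (Y p)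
  have hu := e.map_source hp
  have hrel := (darboux_form hS he hp rfl rfl rfl rfl).1
  have hd := fderiv_relation hS he hu
  rw [nijenhuis_congr S hX (mdifferentiableAt_chartField he.1 hp v) hY
    (mdifferentiableAt_chartField he.1 hp w) hv.symm hw.symm, nijenhuis_chartField hS he hp,
    ← hS p X Y hX hY, ← hv, ← hw, g_φ_chartField_of_isDarbouxChart hS he hp, ξ_eq hS he hp,
    sub_eq_zero, ← chartField_basisVec, ← chartField_smul, ← chartField_smul]
  congr 1
  obtain ⟨ha, hb, hc⟩ := h _ hu
  rw [zDeriv] at ha hb hc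
  set u := e p
  have hx := hd (E3.basisVec 0)
  have hy := hd (E3.basisVec 1)
  have hA : ∀ x : E3, fderiv ℝ (S.metricCoeff e 0 0) u x = _ := fun x => E3.map_eq _ x
  have hB : ∀ x : E3, fderiv ℝ (S.metricCoeff e 0 1) u x = _ := fun x => E3.map_eq _ x
  have hC : ∀ x : E3, fderiv ℝ (S.metricCoeff e 1 1) u x = _ := fun x => E3.map_eq _ x
  simp only [S.fderiv_phiField he.1 hu]
  simp only [phiField]
  rw [hA (phiVec _ _ _ _ v), hA (phiVec _ _ _ _ w), hB (phiVec _ _ _ _ v),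
    hB (phiVec _ _ _ _ w), hC (phiVec _ _ _ _ v), hC (phiVec _ _ _ _ w), hA v, hA w, hB v, hB w,
    hC v, hC w, ha, hb, hc]
  simp at hx hy
  ext i
  fin_cases i
  · simp [phiVec]
    linear_combination (-(v 0 * w 1 - v 1 * w 0)) * hy
  · simp [phiVec]
    linear_combination (v 0 * w 1 - v 1 * w 0) * hx
  · simp [phiVec]
    linear_combination (-(v 0 * w 1 - v 1 * w 0)) * (u 1 * hy + hrel)

end AlmostParacontactMetric

/-! ### The main theorem, with a, b, c equal to four times the metric coefficients. -/

theorem mainTheorem10 (M : Type*) [TopologicalSpace M] [ChartedSpace E3 M]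
    [IsManifold 𝓘(ℝ, E3) ∞ M] (S : AlmostParacontactMetric E3 M) (hS : S.IsParacontactMetric) :
    -- Darboux coordinates exist around every point
    (∀ p : M, ∃ e : OpenPartialHomeomorph M E3,
      IsDarbouxChart S.η e ∧ p ∈ e.source ∧ Convex ℝ e.target) ∧
    -- in any Darboux coordinates the structure has the following form
    (∀ e : OpenPartialHomeomorph M E3, IsDarbouxChart S.η e →
      ∃ a b c : E3 → ℝ,
        ContDiffOn ℝ ∞ a e.target ∧ ContDiffOn ℝ ∞ b e.target ∧ ContDiffOn ℝ ∞ c e.target ∧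
        (∀ u ∈ e.target, a u * c u - b u ^ 2 - c u * u 1 ^ 2 = -1) ∧
        (∀ p ∈ e.source,
          S.ξ p = (2 : ℝ) • coordField e 2 p ∧
          S.η p = (1 / 2 : ℝ) • (coordDiff e 2 p - e p 1 • coordDiff e 0 p) ∧
          (∀ i j, S.g p (coordField e i p) (coordField e j p) =
            metricMatrix (a (e p)) (b (e p)) (c (e p)) (e p 1) i j) ∧
          (∀ j, S.φ p (coordField e j p) =
            ∑ i, phiMatrix (a (e p)) (b (e p)) (c (e p)) (e p 1) i j • coordField e i p)) ∧
        -- i) characterization of paraSasakian structures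
        (S.IsParaSasakianOn e.source ↔
          NotDependOnZ a e.target ∧ NotDependOnZ b e.target ∧ NotDependOnZ c e.target) ∧
        -- ii) characterization of `h² = 0`, at every point of the coordinate domain
        (∀ p ∈ e.source,
          (S.h p ∘L S.h p = 0 ↔
            LinearMap.trace ℝ (TangentSpace 𝓘(ℝ, E3) p) (S.h p ∘L S.h p).toLinearMap = 0) ∧
          (S.h p ∘L S.h p = 0 ↔
            zDeriv b (e p) ^ 2 - zDeriv a (e p) * zDeriv c (e p) = 0))) := by
  refine ⟨AlmostParacontactMetric.exists_isDarbouxChart hS, fun e he => ?_⟩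
  have hd : ∀ i j, ∀ u ∈ e.target, DifferentiableAt ℝ (S.metricCoeff e i j) u := fun i j u hu =>
    (S.contDiffAt_metricCoeff he.1 i j hu).differentiableAt (by simp)
  have hs : ∀ i j, ContDiffOn ℝ ∞ (S.metricCoeff e i j) e.target := fun i j u hu =>
    (S.contDiffAt_metricCoeff he.1 i j hu).contDiffWithinAt
  refine ⟨S.metricCoeff e 0 0, S.metricCoeff e 0 1, S.metricCoeff e 1 1, hs 0 0, hs 0 1, hs 1 1,
    fun u hu => ?_, fun p hp => ⟨AlmostParacontactMetric.ξ_eq hS he hp, he.2 p hp, ?_, ?_⟩, ?_,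
    fun p hp => ⟨?_, AlmostParacontactMetric.h_h_eq_zero_iff hS he hp⟩⟩
  · have h := (AlmostParacontactMetric.darboux_form hS he (e.map_target hu) rfl rfl rfl rfl).1
    rwa [e.right_inv hu] at h
  · have h2 : ∀ i, S.g p (coordField e i p) (coordField e 2 p) =
        1 / 4 * (E3.basisVec i 2 - e p 1 * E3.basisVec i 0) := fun i =>
      AlmostParacontactMetric.g_coordField_two hS he hp (E3.basisVec i)
    have h2' : ∀ i, S.g p (coordField e 2 p) (coordField e i p) =
        1 / 4 * (E3.basisVec i 2 - e p 1 * E3.basisVec i 0) := fun i => by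
      rw [S.g_symm, h2]
    have h10 := S.g_symm p (coordField e 1 p) (coordField e 0 p)
    rw [S.g_coordField hp 0 1] at h10
    intro i j
    fin_cases i <;> fin_cases j <;>
      simp [metricMatrix, h2, h2', h10, S.g_coordField hp 0 0, S.g_coordField hp 0 1,
        S.g_coordField hp 1 1]
  · intro j
    have h := AlmostParacontactMetric.φ_chartField hS he hp (E3.basisVec j)
    rw [chartField_basisVec, chartField_eq_sum] at h
    rw [h]
    refine Finset.sum_congr rfl fun i _ => ?_
    congr 1
    fin_cases i <;> fin_cases j <;>
      simp [phiMatrix, AlmostParacontactMetric.phiField, AlmostParacontactMetric.phiVec] <;> ring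
  · rw [notDependOnZ_iff e.open_target (hd 0 0), notDependOnZ_iff e.open_target (hd 0 1),
      notDependOnZ_iff e.open_target (hd 1 1)]
    constructor
    · intro h
      have h1 := fun u hu => AlmostParacontactMetric.zDeriv_eq_zero_of_isNormalOn hS he h.2 (u := u) hu
      exact ⟨fun u hu => (h1 u hu).1, fun u hu => (h1 u hu).2.1, fun u hu => (h1 u hu).2.2⟩
    · rintro ⟨h1, h2, h3⟩
      exact ⟨hS, AlmostParacontactMetric.isNormalOn_of_zDeriv_eq_zero hS he
        fun u hu => ⟨h1 u hu, h2 u hu, h3 u hu⟩⟩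
  · rw [AlmostParacontactMetric.trace_h_h hS he hp, AlmostParacontactMetric.h_h_eq_zero_iff hS he hp]
    simp
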